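/- Let $k$ be a commutative unital ring; algebras are associative $k$-algebras, not necessarily unital, and a product $S\cdot T$ of $k$-submodules of an algebra is the $k$-span of the products $st$, $s\in S$, $t\in T$. An algebra $R$ has *orthogonal local units* if there is a set $E\subseteq R$ of pairwise orthogonal idempotents with $R=\bigoplus_{e\in E}Re=\bigoplus_{e\in E}eR$. The *multiplier algebra* $\mathcal M(R)$ consists of the pairs $w=(\rho,\lambda)$ of $k$-linear maps $R\to R$, written $aw=\rho(a)$, $wa=\lambda(a)$, with $(ab)w=a(bw)$, $w(ab)=(wa)b$ and $(aw)b=a(wb)$; products are given by $a(ww')=(aw)w'$ and $(ww')a=w(w'a)$. A *twisted partial action* $\Theta$ of a group $G$ on an algebra $A$ consists of two-sided ideals $D_g$ of $A$, $k$-algebra isomorphisms $\theta_g:D_{g^{-1}}\to D_g$ ($g\in G$) and invertible multipliers $w_{g,h}\in\mathcal M(D_g\cdot D_{gh})$ ($g,h\in G$) such that for all $g,h,t\in G$: (i) $D_g\cdot D_g=D_g$ and $D_g\cdot D_h=D_h\cdot D_g$; (ii) $D_1=A$ and $\theta_1=\mathrm{id}_A$; (iii) $\theta_g(D_{g^{-1}}\cdot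 D_h)=D_g\cdot D_{gh}$; (iv) $\theta_g(\theta_h(a))=w_{g,h}\,\theta_{gh}(a)\,w_{g,h}^{-1}$ for $a\in D_{h^{-1}}\cdot D_{h^{-1}g^{-1}}$; (v) $w_{1,g}=w_{g,1}=1$; (vi) $\theta_g(a\,w_{h,t})\,w_{g,ht}=\theta_g(a)\,w_{g,h}\,w_{gh,t}$ for $a\in D_{g^{-1}}\cdot D_h\cdot D_{ht}$. The *crossed product* $A\rtimes_\Theta G$ is $\bigoplus_{g\in G}D_g\delta_g$ with the $k$-bilinear multiplication $(a\delta_g)(b\delta_h)=\theta_g(\theta_g^{-1}(a)\,b)\,w_{g,h}\,\delta_{gh}$, its $g$-homogeneous component being $D_g\delta_g$. For a set $X$, $\mathrm{FMat}_X(R)$ is the algebra of $X\times X$-matrices over $R$ with only finitely many non-zero entries. **Theorem.** Let $G$ be a group and let $B=\bigoplus_{g\in G}B_g$ be a $G$-graded algebra such that $B_g\cdot B_{g^{-1}}\cdot B_g=B_g$ for all $g\in G$ and such that for every $g\in G$ the algebra $B_g\cdot B_{g^{-1}}$ has orthogonal local units. Then there exist an infinite set $X$ and a twisted partial action $\Theta$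 of $G$ on $\mathrm{FMat}_X(B_1)$ such that $$\mathrm{FMat}_X(B)\cong \mathrm{FMat}_X(B_1)\rtimes_\Theta G$$ as graded algebras, the $g$-homogeneous component of $\mathrm{FMat}_X(B)$ being $\mathrm{FMat}_X(B_g)$, $g\in G$; that is, there is an isomorphism of $k$-algebras that maps $\mathrm{FMat}_X(B_g)$ onto $D_g\delta_g$ for every $g\in G$. -/

import Mathlib

universe u v w

open scoped DirectSum

noncomputable section

/-! All algebras are associative, not necessarily unital, over a commutative unital ring `k`. -/

section Products

variable {k A : Type*} [CommRing k] [NonUnitalRing A] [Module k A] [IsScalarTower k A A]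
  [SMulCommClass k A A]

/-- The product `S · T` of two `k`-submodules: the `k`-span of the products `s * t`. -/
def spanMul (S T : Submodule k A) : Submodule k A :=
  Submodule.map₂ (LinearMap.mul k A) S T

infixl:70 " ⊙ " => spanMul

theorem mul_mem_spanMul {S T : Submodule k A} {s t : A} (hs : s ∈ S) (ht : t ∈ T) :
    s * t ∈ S ⊙ T :=
  Submodule.apply_mem_map₂ (LinearMap.mul k A) hs ht

theorem spanMul_le {S T P : Submodule k A} :
    S ⊙ T ≤ P ↔ ∀ s ∈ S, ∀ t ∈ T, s * t ∈ P :=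
  Submodule.map₂_le

theorem spanMul_mono {S S' T T' : Submodule k A} (hS : S ≤ S') (hT : T ≤ T') :
    S ⊙ T ≤ S' ⊙ T' :=
  Submodule.map₂_le_map₂ hS hT

theorem spanMul_assoc (S T P : Submodule k A) : S ⊙ T ⊙ P = S ⊙ (T ⊙ P) := by
  apply le_antisymm
  · rw [spanMul_le]
    intro x hx p hp
    have : S ⊙ T ≤ (S ⊙ (T ⊙ P)).comap (LinearMap.mulRight k p) := by
      rw [spanMul_le]
      intro s hs t ht
      simp only [Submodule.mem_comap, LinearMap.mulRight_apply, mul_assoc]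
      exact mul_mem_spanMul hs (mul_mem_spanMul ht hp)
    exact this hx
  · rw [spanMul_le]
    intro s hs x hx
    have : T ⊙ P ≤ (S ⊙ T ⊙ P).comap (LinearMap.mulLeft k s) := by
      rw [spanMul_le]
      intro t ht p hp
      simp only [Submodule.mem_comap, LinearMap.mulLeft_apply, ← mul_assoc]
      exact mul_mem_spanMul (mul_mem_spanMul hs ht) hp
    exact this hx

end Products

/-- An isomorphism of (not necessarily unital) `k`-algebras. -/
structure NAlgIso (k A B : Type*) [CommRing k] [AddCommMonoid A] [AddCommMonoid B]
    [Module k A] [Module k B] [Mul A] [Mul B] extends A ≃ₗ[k] B where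
  map_mul' : ∀ a b : A, toFun (a * b) = toFun a * toFun b

/-! ### Multipliers -/

/-- A multiplier `w = (R, L)` of an algebra `I`; `right a` is `a w` and `left a` is `w a`. -/
@[ext]
structure Multiplier (k I : Type*) [CommRing k] [NonUnitalRing I] [Module k I] where
  right : I →ₗ[k] I
  left : I →ₗ[k] I
  right_mul : ∀ a b : I, right (a * b) = a * right b
  left_mul : ∀ a b : I, left (a * b) = left a * b
  right_left : ∀ a b : I, right a * b = a * left b

namespace Multiplier

variable {k I : Type*} [CommRing k] [NonUnitalRing I] [Module k I]

/-- The product of multipliers: `a (w w') = (a w) w'` and `(w w') a = w (w' a)`. -/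
instance : Monoid (Multiplier k I) where
  mul w w' :=
    { right := w'.right ∘ₗ w.right
      left := w.left ∘ₗ w'.left
      right_mul := fun a b => by simp [w.right_mul, w'.right_mul]
      left_mul := fun a b => by simp [w.left_mul, w'.left_mul]
      right_left := fun a b => by simp [w.right_left, w'.right_left] }
  one :=
    { right := LinearMap.id
      left := LinearMap.id
      right_mul := fun _ _ => rfl
      left_mul := fun _ _ => rfl
      right_left := fun _ _ => rfl }
  mul_assoc _ _ _ := rfl
  one_mul _ := rfl
  mul_one _ := rfl

end Multiplier

/-! ### Two-sided ideals -/

/-- A two-sided ideal of the `k`-algebra `A`. -/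
structure AlgIdeal (k A : Type*) [CommRing k] [NonUnitalRing A] [Module k A] extends
    Submodule k A where
  mul_mem_left' : ∀ (a : A) {x : A}, x ∈ carrier → a * x ∈ carrier
  mul_mem_right' : ∀ (a : A) {x : A}, x ∈ carrier → x * a ∈ carrier

namespace AlgIdeal

section Basic

variable {k A : Type*} [CommRing k] [NonUnitalRing A] [Module k A]

instance : SetLike (AlgIdeal k A) A where
  coe I := I.carrier
  coe_injective I J h := by
    obtain ⟨I, _, _⟩ := I
    obtain ⟨J, _, _⟩ := J
    obtain rfl : I = J := SetLike.coe_injective h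
    rfl

instance : PartialOrder (AlgIdeal k A) := PartialOrder.ofSetLike (AlgIdeal k A) A

instance : NonUnitalSubringClass (AlgIdeal k A) A where
  add_mem {I} := I.add_mem'
  zero_mem I := I.zero_mem'
  neg_mem {I} _ hx := I.toSubmodule.neg_mem hx
  mul_mem {I} a _ _ hb := I.mul_mem_left' a hb

instance : SMulMemClass (AlgIdeal k A) k A where
  smul_mem {I} c _ hx := I.smul_mem' c hx

end Basic

variable {k A : Type*} [CommRing k] [NonUnitalRing A] [Module k A] [IsScalarTower k A A]
  [SMulCommClass k A A]

/-- The product of two ideals, i.e. the `k`-span of the products of their elements. -/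
instance : Mul (AlgIdeal k A) where
  mul I J :=
    { toSubmodule := I.toSubmodule ⊙ J.toSubmodule
      mul_mem_left' := fun a x hx => by
        have : I.toSubmodule ⊙ J.toSubmodule ≤
            (I.toSubmodule ⊙ J.toSubmodule).comap (LinearMap.mulLeft k a) := by
          rw [spanMul_le]
          intro s hs t ht
          simp only [Submodule.mem_comap, LinearMap.mulLeft_apply, ← mul_assoc]
          exact mul_mem_spanMul (I.mul_mem_left' a hs) ht
        exact this hx
      mul_mem_right' := fun a x hx => by
        have : I.toSubmodule ⊙ J.toSubmodule ≤
            (I.toSubmodule ⊙ J.toSubmodule).comap (LinearMap.mulRight k a) := by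
          rw [spanMul_le]
          intro s hs t ht
          simp only [Submodule.mem_comap, LinearMap.mulRight_apply, mul_assoc]
          exact mul_mem_spanMul hs (J.mul_mem_right' a ht)
        exact this hx }

theorem mul_mem_mul {I J : AlgIdeal k A} {x y : A} (hx : x ∈ I) (hy : y ∈ J) :
    x * y ∈ I * J :=
  mul_mem_spanMul (S := I.toSubmodule) (T := J.toSubmodule) hx hy

theorem mul_le {I J : AlgIdeal k A} {P : Submodule k A} :
    (I * J).toSubmodule ≤ P ↔ ∀ x ∈ I, ∀ y ∈ J, x * y ∈ P :=
  spanMul_le (S := I.toSubmodule) (T := J.toSubmodule)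

theorem mul_le_left {I J : AlgIdeal k A} : I * J ≤ I :=
  mul_le.2 fun _ hx y _ => I.mul_mem_right' y hx

theorem mul_le_right {I J : AlgIdeal k A} : I * J ≤ J :=
  mul_le.2 fun x _ _ hy => J.mul_mem_left' x hy

theorem mul_mono {I I' J J' : AlgIdeal k A} (hI : I ≤ I') (hJ : J ≤ J') :
    I * J ≤ I' * J' :=
  mul_le.2 fun _ hx _ hy => mul_mem_mul (hI hx) (hJ hy)

theorem mul_assoc' (I J K : AlgIdeal k A) : I * J * K = I * (J * K) :=
  SetLike.coe_injective (congrArg (fun S : Submodule k A => (S : Set A))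
    (spanMul_assoc I.toSubmodule J.toSubmodule K.toSubmodule))

/-- A multiplier of an idempotent ideal `I` preserves `J * I`. -/
theorem right_mem {I J : AlgIdeal k A} (hI : I * I = I) (w : Multiplier k I) (a : I)
    (ha : (a : A) ∈ J * I) : (w.right a : A) ∈ J * I := by
  let P : Submodule k A :=
    ((J * I).toSubmodule.comap (I.toSubmodule.subtype ∘ₗ w.right)).map I.toSubmodule.subtype
  have key : (J * I).toSubmodule ≤ P := by
    have h2 : J * I = J * I * I := by rw [mul_assoc', hI]
    rw [h2, mul_le]
    intro x hx y hy
    have hxI : x ∈ I := mul_le_right hx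
    refine ⟨(⟨x, hxI⟩ : I) * ⟨y, hy⟩, ?_, rfl⟩
    change (w.right ((⟨x, hxI⟩ : I) * ⟨y, hy⟩) : A) ∈ J * I
    rw [w.right_mul]
    exact (J * I).mul_mem_right' _ hx
  obtain ⟨b, hb, hba⟩ := key ha
  obtain rfl : b = a := Subtype.ext hba
  exact hb

end AlgIdeal

/-! ### Twisted partial actions and their crossed products -/

/-- The domains and the isomorphisms of a twisted partial action, with the axioms that do not
involve the twisting. -/
structure PartialActionData (k G A : Type*) [CommRing k] [Group G] [NonUnitalRing A]
    [Module k A] [IsScalarTower k A A] [SMulCommClass k A A] where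
  D : G → AlgIdeal k A
  θ : ∀ g, NAlgIso k (D g⁻¹) (D g)
  D_mul_self : ∀ g, D g * D g = D g
  D_mul_comm : ∀ g h, D g * D h = D h * D g
  mem_D_one : ∀ a, a ∈ D 1
  θ_one : ∀ a : D (1 : G)⁻¹, ((θ 1).toLinearEquiv a : A) = a
  map_θ : ∀ g h,
    (fun a : D g⁻¹ => ((θ g).toLinearEquiv a : A)) '' {a | (a : A) ∈ D g⁻¹ * D h} =
      ((D g * D (g * h) : AlgIdeal k A) : Set A)

namespace PartialActionData

variable {k G A : Type*} [CommRing k] [Group G] [NonUnitalRing A]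
    [Module k A] [IsScalarTower k A A] [SMulCommClass k A A] (Θ : PartialActionData k G A)

theorem θ_mem {g h : G} {a : A} (ha : a ∈ Θ.D g⁻¹ * Θ.D h) :
    ((Θ.θ g).toLinearEquiv ⟨a, AlgIdeal.mul_le_left ha⟩ : A) ∈ Θ.D g * Θ.D (g * h) := by
  rw [← SetLike.mem_coe, ← Θ.map_θ]
  exact ⟨⟨a, AlgIdeal.mul_le_left ha⟩, ha, rfl⟩

theorem mul_idem (g h : G) : Θ.D g * Θ.D h * (Θ.D g * Θ.D h) = Θ.D g * Θ.D h := by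
  rw [AlgIdeal.mul_assoc', ← AlgIdeal.mul_assoc' (Θ.D h), Θ.D_mul_comm h g,
    AlgIdeal.mul_assoc', Θ.D_mul_self, ← AlgIdeal.mul_assoc', Θ.D_mul_self]

theorem θ_mem₃ {g h f : G} {a : A} (ha : a ∈ Θ.D g⁻¹ * Θ.D h * Θ.D f) (h' : a ∈ Θ.D g⁻¹) :
    ((Θ.θ g).toLinearEquiv ⟨a, h'⟩ : A) ∈ Θ.D (g * f) * (Θ.D g * Θ.D (g * h)) := by
  let Q := Θ.D (g * f) * (Θ.D g * Θ.D (g * h))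
  let P : Submodule k A :=
    (Q.toSubmodule.comap ((Θ.D g).toSubmodule.subtype ∘ₗ
      ((Θ.θ g).toLinearEquiv : Θ.D g⁻¹ →ₗ[k] Θ.D g))).map (Θ.D g⁻¹).toSubmodule.subtype
  have e : Θ.D g⁻¹ * Θ.D h * Θ.D f = Θ.D g⁻¹ * Θ.D f * (Θ.D g⁻¹ * Θ.D h) := by
    rw [AlgIdeal.mul_assoc' _ (Θ.D f), ← AlgIdeal.mul_assoc' (Θ.D f), Θ.D_mul_comm f,
      AlgIdeal.mul_assoc' _ (Θ.D f), ← AlgIdeal.mul_assoc' _ _ (Θ.D f * _), Θ.D_mul_self,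
      Θ.D_mul_comm f, AlgIdeal.mul_assoc']
  have key : (Θ.D g⁻¹ * Θ.D h * Θ.D f).toSubmodule ≤ P := by
    rw [e, AlgIdeal.mul_le]
    intro x hx y hy
    refine ⟨(⟨x, AlgIdeal.mul_le_left hx⟩ : Θ.D g⁻¹) * ⟨y, AlgIdeal.mul_le_left hy⟩, ?_, rfl⟩
    have := (Θ.θ g).map_mul' ⟨x, AlgIdeal.mul_le_left hx⟩ ⟨y, AlgIdeal.mul_le_left hy⟩
    change (((Θ.θ g).toFun _ : Θ.D g) : A) ∈ Q
    rw [this]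
    exact AlgIdeal.mul_mem_mul (AlgIdeal.mul_le_right (Θ.θ_mem hx)) (Θ.θ_mem hy)
  obtain ⟨b, hb, hba⟩ := key ha
  obtain rfl : b = ⟨a, h'⟩ := Subtype.ext hba
  exact hb

theorem conj_mem₁ {g h : G} {a : A} (ha : a ∈ Θ.D h⁻¹ * Θ.D (h⁻¹ * g⁻¹)) :
    ((Θ.θ h).toLinearEquiv ⟨a, AlgIdeal.mul_le_left ha⟩ : A) ∈ Θ.D g⁻¹ := by
  have := AlgIdeal.mul_le_right (Θ.θ_mem ha)
  rwa [mul_inv_cancel_left] at this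

theorem conj_mem₂ {g h : G} {a : A} (ha : a ∈ Θ.D h⁻¹ * Θ.D (h⁻¹ * g⁻¹)) :
    a ∈ Θ.D (g * h)⁻¹ := by
  have := AlgIdeal.mul_le_right ha
  rwa [← mul_inv_rev] at this

theorem conj_mem₃ {g h : G} {a : A} (ha : a ∈ Θ.D h⁻¹ * Θ.D (h⁻¹ * g⁻¹)) :
    ((Θ.θ (g * h)).toLinearEquiv ⟨a, Θ.conj_mem₂ ha⟩ : A) ∈ Θ.D g * Θ.D (g * h) := by
  have h1 : a ∈ Θ.D (g * h)⁻¹ * Θ.D h⁻¹ := by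
    rw [← mul_inv_rev] at ha
    rwa [Θ.D_mul_comm]
  have := Θ.θ_mem h1
  rwa [mul_inv_cancel_right, Θ.D_mul_comm] at this

theorem cocycle_mem₁ {g h f : G} {a : A} (ha : a ∈ Θ.D g⁻¹ * Θ.D h * Θ.D f) :
    a ∈ Θ.D h * Θ.D f := by
  rw [AlgIdeal.mul_assoc'] at ha
  exact AlgIdeal.mul_le_right ha

theorem cocycle_mem₂ {g h f : G} {a : A} (ha : a ∈ Θ.D g⁻¹ * Θ.D h * Θ.D f)
    (w : Multiplier k ↥(Θ.D h * Θ.D f)) :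
    (w.right ⟨a, Θ.cocycle_mem₁ ha⟩ : A) ∈ Θ.D g⁻¹ * Θ.D f := by
  have h1 := AlgIdeal.right_mem (J := Θ.D g⁻¹) (Θ.mul_idem h f) w ⟨a, Θ.cocycle_mem₁ ha⟩
    (by rwa [AlgIdeal.mul_assoc'] at ha)
  exact AlgIdeal.mul_mono le_rfl AlgIdeal.mul_le_right h1

theorem cocycle_mem₃ {g h f : G} {a : A} (ha : a ∈ Θ.D g⁻¹ * Θ.D h * Θ.D f)
    (w : Multiplier k ↥(Θ.D g * Θ.D (g * h))) :
    (w.right ⟨(Θ.θ g).toLinearEquiv ⟨a, AlgIdeal.mul_le_left (AlgIdeal.mul_le_left ha)⟩,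
      Θ.θ_mem (AlgIdeal.mul_le_left ha)⟩ : A) ∈ Θ.D (g * h) * Θ.D (g * f) := by
  have h1 := AlgIdeal.right_mem (J := Θ.D (g * f)) (Θ.mul_idem g (g * h)) w
    ⟨_, Θ.θ_mem (AlgIdeal.mul_le_left ha)⟩ (Θ.θ_mem₃ ha _)
  rw [Θ.D_mul_comm (g * h)]
  exact AlgIdeal.mul_mono le_rfl AlgIdeal.mul_le_right h1

end PartialActionData

/-- A twisted partial action `Θ = ({D_g}, {θ_g}, {w_{g,h}})` of `G` on the algebra `A`. The anonymous
membership proofs say that all maps below are applied to elements of their domains. -/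
structure TwistedPartialAction (k G A : Type*) [CommRing k] [Group G] [NonUnitalRing A]
    [Module k A] [IsScalarTower k A A] [SMulCommClass k A A] extends
    PartialActionData k G A where
  w : ∀ g h : G, (Multiplier k ↥(D g * D (g * h)))ˣ
  /-- `θ_g (θ_h a) = w_{g,h} (θ_{gh} a) w_{g,h}⁻¹` for `a ∈ D_{h⁻¹} · D_{h⁻¹ g⁻¹}`. -/
  conj : ∀ (g h : G) (a : A) (ha : a ∈ D h⁻¹ * D (h⁻¹ * g⁻¹)),
    ((θ g).toLinearEquiv ⟨(θ h).toLinearEquiv ⟨a, AlgIdeal.mul_le_left ha⟩,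
        toPartialActionData.conj_mem₁ ha⟩ : A) =
      (w g h)⁻¹.val.right ((w g h).val.left
        ⟨(θ (g * h)).toLinearEquiv ⟨a, toPartialActionData.conj_mem₂ ha⟩,
          toPartialActionData.conj_mem₃ ha⟩)
  w_one_left : ∀ g : G, w 1 g = 1
  w_one_right : ∀ g : G, w g 1 = 1
  /-- `θ_g (a w_{h,t}) w_{g,ht} = θ_g (a) w_{g,h} w_{gh,t}` for
  `a ∈ D_{g⁻¹} · D_h · D_{ht}`. -/
  cocycle : ∀ (g h t : G) (a : A) (ha : a ∈ D g⁻¹ * D h * D (h * t)),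
    ((w g (h * t)).val.right
      ⟨(θ g).toLinearEquiv ⟨(w h t).val.right ⟨a, toPartialActionData.cocycle_mem₁ ha⟩,
          AlgIdeal.mul_le_left (toPartialActionData.cocycle_mem₂ ha (w h t).val)⟩,
        toPartialActionData.θ_mem (toPartialActionData.cocycle_mem₂ ha (w h t).val)⟩ : A) =
      (w (g * h) t).val.right
        ⟨(w g h).val.right
          ⟨(θ g).toLinearEquiv ⟨a, AlgIdeal.mul_le_left (AlgIdeal.mul_le_left ha)⟩,
            toPartialActionData.θ_mem (AlgIdeal.mul_le_left ha)⟩,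
          (mul_assoc g h t).symm ▸ toPartialActionData.cocycle_mem₃ ha (w g h).val⟩

namespace TwistedPartialAction

variable {k G A : Type*} [CommRing k] [Group G] [NonUnitalRing A]
    [Module k A] [IsScalarTower k A A] [SMulCommClass k A A] (Θ : TwistedPartialAction k G A)

/-- The product of `A`, as a bilinear map `D_{g⁻¹} × D_h → D_{g⁻¹} · D_h`. -/
def pairing (g h : G) : Θ.D g⁻¹ →ₗ[k] Θ.D h →ₗ[k] ↥(Θ.D g⁻¹ * Θ.D h) :=
  LinearMap.mk₂ k (fun a b => ⟨a * b, AlgIdeal.mul_mem_mul a.2 b.2⟩)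
    (fun _ _ _ => Subtype.ext (add_mul _ _ _)) (fun _ _ _ => Subtype.ext (smul_mul_assoc _ _ _))
    (fun _ _ _ => Subtype.ext (mul_add _ _ _)) (fun _ _ _ => Subtype.ext (mul_smul_comm _ _ _))

/-- The restriction `D_{g⁻¹} · D_h → D_g · D_{gh}` of `θ_g`. -/
def θRestrict (g h : G) : ↥(Θ.D g⁻¹ * Θ.D h) →ₗ[k] ↥(Θ.D g * Θ.D (g * h)) where
  toFun a := ⟨(Θ.θ g).toLinearEquiv ⟨a, AlgIdeal.mul_le_left a.2⟩, Θ.θ_mem a.2⟩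
  map_add' a b := Subtype.ext (congrArg (fun z : Θ.D g => (z : A))
    ((Θ.θ g).toLinearEquiv.map_add ⟨a, AlgIdeal.mul_le_left a.2⟩ ⟨b, AlgIdeal.mul_le_left b.2⟩))
  map_smul' c a := Subtype.ext (congrArg (fun z : Θ.D g => (z : A))
    ((Θ.θ g).toLinearEquiv.map_smul c ⟨a, AlgIdeal.mul_le_left a.2⟩))

/-- The inclusion `D_g · D_{gh} ⊆ D_{gh}`. -/
def inclusion (g h : G) : ↥(Θ.D g * Θ.D (g * h)) →ₗ[k] Θ.D (g * h) where
  toFun a := ⟨a, AlgIdeal.mul_le_right a.2⟩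
  map_add' _ _ := rfl
  map_smul' _ _ := rfl

/-- `(a, b) ↦ θ_g (θ_g⁻¹ (a) b) w_{g,h}`, for `a ∈ D_g` and `b ∈ D_h`. -/
def mulComponent (g h : G) : Θ.D g →ₗ[k] Θ.D h →ₗ[k] Θ.D (g * h) :=
  (Θ.pairing g h ∘ₗ ((Θ.θ g).toLinearEquiv.symm : Θ.D g →ₗ[k] Θ.D g⁻¹)).compr₂
    (Θ.inclusion g h ∘ₗ (Θ.w g h).val.right ∘ₗ Θ.θRestrict g h)

/-- The crossed product `A ⋊_Θ G = ⨁_g D_g δ_g`. -/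
def CrossedProduct : Type _ := ⨁ g : G, Θ.D g

namespace CrossedProduct

instance : AddCommGroup Θ.CrossedProduct := inferInstanceAs (AddCommGroup (⨁ g : G, Θ.D g))

instance : Module k Θ.CrossedProduct := inferInstanceAs (Module k (⨁ g : G, Θ.D g))

variable [DecidableEq G]

/-- `a ↦ a δ_g`, for `a ∈ D_g`. -/
def δ (g : G) : Θ.D g →ₗ[k] Θ.CrossedProduct := DirectSum.lof k G (fun g => Θ.D g) g

/-- The bilinear map with `(a δ_g, b δ_h) ↦ θ_g (θ_g⁻¹ (a) b) w_{g,h} δ_{gh}`. -/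
def mulHom : Θ.CrossedProduct →ₗ[k] Θ.CrossedProduct →ₗ[k] Θ.CrossedProduct :=
  DirectSum.toModule k G _ fun g => LinearMap.flip <|
    DirectSum.toModule k G _ fun h => LinearMap.flip <|
      (Θ.mulComponent g h).compr₂ (δ Θ (g * h))

instance : NonUnitalNonAssocRing Θ.CrossedProduct where
  mul x y := mulHom Θ x y
  left_distrib x := (mulHom Θ x).map_add
  right_distrib := (mulHom Θ).map_add₂
  zero_mul := (mulHom Θ).map_zero₂
  mul_zero x := (mulHom Θ x).map_zero

theorem δ_mul_δ (g h : G) (a : Θ.D g) (b : Θ.D h) :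
    δ Θ g a * δ Θ h b = δ Θ (g * h) (Θ.mulComponent g h a b) := by
  change mulHom Θ (δ Θ g a) (δ Θ h b) = _
  unfold mulHom δ
  erw [DirectSum.toModule_lof, LinearMap.flip_apply, DirectSum.toModule_lof]
  rfl

end CrossedProduct

end TwistedPartialAction

/-! ### Matrices with finitely many non-zero entries -/

/-- The `X × X`-matrices over `R` with only finitely many non-zero entries. -/
def FMat (X R : Type*) [Zero R] : Type _ := X × X →₀ R

namespace FMat

section Ring

variable {X R : Type*} [NonUnitalRing R]

instance : AddCommGroup (FMat X R) := inferInstanceAs (AddCommGroup (X × X →₀ R))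

/-- The `(x, y)`-entry of a matrix. -/
def entry (a : FMat X R) (x y : X) : R := (show X × X →₀ R from a) (x, y)

@[ext]
theorem ext {a b : FMat X R} (h : ∀ x y, a.entry x y = b.entry x y) : a = b :=
  Finsupp.ext fun p => h p.1 p.2

theorem entry_zero (x y : X) : (0 : FMat X R).entry x y = 0 := rfl

theorem entry_add (a b : FMat X R) (x y : X) :
    (a + b).entry x y = a.entry x y + b.entry x y := rfl

open Classical in
/-- The finite set of (indices of) non-zero columns. -/
def cols (a : FMat X R) : Finset X := (show X × X →₀ R from a).support.image Prod.snd

theorem entry_eq_zero {a : FMat X R} {x y : X} (h : y ∉ a.cols) : a.entry x y = 0 := by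
  classical
  by_contra h'
  exact h (Finset.mem_image.2 ⟨(x, y), Finsupp.mem_support_iff.2 h', rfl⟩)

open Classical in
/-- Matrix multiplication; the sum over the middle index runs over the non-zero columns of the
first factor. -/
instance : Mul (FMat X R) where
  mul a b := Finsupp.onFinset
    ((show X × X →₀ R from a).support.image Prod.fst ×ˢ b.cols)
    (fun p => ∑ y ∈ a.cols, a.entry p.1 y * b.entry y p.2) (by
      intro p hp
      obtain ⟨y, -, hy⟩ := Finset.exists_ne_zero_of_sum_ne_zero hp
      refine Finset.mem_product.2 ⟨Finset.mem_image.2 ⟨(p.1, y),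
        Finsupp.mem_support_iff.2 (left_ne_zero_of_mul hy), rfl⟩, ?_⟩
      by_contra h
      exact right_ne_zero_of_mul hy (entry_eq_zero h))

theorem entry_mul (a b : FMat X R) (x z : X) :
    (a * b).entry x z = ∑ y ∈ a.cols, a.entry x y * b.entry y z := rfl

theorem entry_mul_of_subset (a b : FMat X R) (x z : X) {S : Finset X} (hS : a.cols ⊆ S) :
    (a * b).entry x z = ∑ y ∈ S, a.entry x y * b.entry y z := by
  rw [entry_mul]
  exact Finset.sum_subset hS fun y _ hy => by rw [entry_eq_zero hy, zero_mul]

instance : NonUnitalRing (FMat X R) where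
  left_distrib a b c := by
    ext x z
    simp only [entry_mul, entry_add, mul_add, Finset.sum_add_distrib]
  right_distrib a b c := by
    classical
    ext x z
    have h1 : (a + b).cols ⊆ a.cols ∪ b.cols ∪ (a + b).cols := Finset.subset_union_right
    have h2 : a.cols ⊆ a.cols ∪ b.cols ∪ (a + b).cols :=
      Finset.subset_union_left.trans Finset.subset_union_left
    have h3 : b.cols ⊆ a.cols ∪ b.cols ∪ (a + b).cols :=
      Finset.subset_union_right.trans Finset.subset_union_left
    simp only [entry_add, entry_mul_of_subset _ _ _ _ h1, entry_mul_of_subset _ _ _ _ h2,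
      entry_mul_of_subset _ _ _ _ h3, add_mul, Finset.sum_add_distrib]
  zero_mul a := by
    ext x z
    simp [entry_mul, entry_zero]
  mul_zero a := by
    ext x z
    simp [entry_mul, entry_zero]
  mul_assoc a b c := by
    classical
    ext x z
    have h1 : (a * b).cols ⊆ b.cols ∪ (a * b).cols := Finset.subset_union_right
    have h2 : b.cols ⊆ b.cols ∪ (a * b).cols := Finset.subset_union_left
    rw [entry_mul_of_subset _ _ _ _ h1, entry_mul]
    simp only [entry_mul_of_subset b c _ _ h2, entry_mul a b, Finset.sum_mul, Finset.mul_sum,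
      mul_assoc]
    exact Finset.sum_comm

end Ring

section Algebra

variable {X k R : Type*} [CommRing k] [NonUnitalRing R] [Module k R]

instance : Module k (FMat X R) := inferInstanceAs (Module k (X × X →₀ R))

theorem entry_smul (c : k) (a : FMat X R) (x y : X) :
    (c • a).entry x y = c • a.entry x y := rfl

instance [IsScalarTower k R R] : IsScalarTower k (FMat X R) (FMat X R) where
  smul_assoc c a b := by
    classical
    ext x z
    have h1 : (c • a).cols ⊆ a.cols ∪ (c • a).cols := Finset.subset_union_right
    have h2 : a.cols ⊆ a.cols ∪ (c • a).cols := Finset.subset_union_left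
    simp only [smul_eq_mul, entry_smul, entry_mul_of_subset _ _ _ _ h1,
      entry_mul_of_subset _ _ _ _ h2, Finset.smul_sum, smul_mul_assoc]

instance [SMulCommClass k R R] : SMulCommClass k (FMat X R) (FMat X R) where
  smul_comm c a b := by
    ext x z
    simp only [smul_eq_mul, entry_smul, entry_mul, Finset.smul_sum, mul_smul_comm]

/-- `FMat_X(S)` inside `FMat_X(R)`, for a submodule `S` of `R`. -/
def component (X : Type*) (S : Submodule k R) : Submodule k (FMat X R) where
  carrier := {a | ∀ x y, a.entry x y ∈ S}
  add_mem' ha hb x y := S.add_mem (ha x y) (hb x y)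
  zero_mem' _ _ := S.zero_mem
  smul_mem' c _ ha x y := S.smul_mem c (ha x y)

end Algebra

end FMat

/-! ### Graded algebras with enough local units -/

/-- `R` has orthogonal local units: there is a set `E` of pairwise orthogonal idempotents of `R`
with `R = ⨁_{e ∈ E} R e = ⨁_{e ∈ E} e R`. -/
def HasOrthogonalLocalUnits (k R : Type*) [CommRing k] [NonUnitalRing R] [Module k R]
    [IsScalarTower k R R] [SMulCommClass k R R] : Prop :=
  open scoped Classical in
  ∃ E : Set R, (∀ e ∈ E, e * e = e) ∧ (∀ e ∈ E, ∀ f ∈ E, e ≠ f → e * f = 0) ∧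
    DirectSum.IsInternal (fun e : E => LinearMap.range (LinearMap.mulRight k (e : R))) ∧
    DirectSum.IsInternal (fun e : E => LinearMap.range (LinearMap.mulLeft k (e : R)))

section Graded

variable {k G B : Type*} [CommRing k] [Group G] [DecidableEq G] [NonUnitalRing B]
    [Module k B] [IsScalarTower k B B] [SMulCommClass k B B]

/-- `B = ⨁_g B_g` is a `G`-graded algebra: `B_g B_h ⊆ B_{gh}`. -/
structure IsGrading (𝓑 : G → Submodule k B) : Prop where
  internal : DirectSum.IsInternal 𝓑
  mul_mem : ∀ {g h : G} {a b : B}, a ∈ 𝓑 g → b ∈ 𝓑 h → a * b ∈ 𝓑 (g * h)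

namespace IsGrading

variable {𝓑 : G → Submodule k B} (h𝓑 : IsGrading 𝓑)

/-- The algebra `B_1`. -/
def unitComponent : NonUnitalSubalgebra k B where
  toNonUnitalSubsemiring :=
    { carrier := 𝓑 1
      add_mem' := (𝓑 1).add_mem
      zero_mem' := (𝓑 1).zero_mem
      mul_mem' := fun ha hb => by simpa using h𝓑.mul_mem ha hb }
  smul_mem' c _ hx := (𝓑 1).smul_mem c hx

/-- The algebra `D_g = B_g · B_{g⁻¹}`. -/
def prodComponent (g : G) : NonUnitalSubalgebra k B where
  toNonUnitalSubsemiring :=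
    { carrier := 𝓑 g ⊙ 𝓑 g⁻¹
      add_mem' := (𝓑 g ⊙ 𝓑 g⁻¹).add_mem
      zero_mem' := (𝓑 g ⊙ 𝓑 g⁻¹).zero_mem
      mul_mem' := fun {a b} ha hb => by
        have h1 : 𝓑 g ⊙ 𝓑 g⁻¹ ≤ 𝓑 1 :=
          spanMul_le.2 fun x hx y hy => by simpa using h𝓑.mul_mem hx hy
        have h2 : 𝓑 g ⊙ 𝓑 g⁻¹ ≤ (𝓑 g ⊙ 𝓑 g⁻¹).comap (LinearMap.mulRight k b) := by
          refine spanMul_le.2 fun x hx y hy => ?_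
          simp only [Submodule.mem_comap, LinearMap.mulRight_apply, mul_assoc]
          exact mul_mem_spanMul hx (by simpa using h𝓑.mul_mem hy (h1 hb))
        exact h2 ha }
  smul_mem' c _ hx := (𝓑 g ⊙ 𝓑 g⁻¹).smul_mem c hx

/-- The graded algebra has enough local units: every `D_g` has orthogonal local units. -/
def HasEnoughLocalUnits : Prop := ∀ g : G, HasOrthogonalLocalUnits k (h𝓑.prodComponent g)

end IsGrading

end Graded

end

/-! Put `C_g = FMat_X(B_g)` and `D_g = C_g C_{g⁻¹}`. Suppose that for every `g` there is an
"invertible multiplier" `u_g` with `D_g u_g = C_g` and `u_g C_{g⁻¹} = D_g`, and that `u_1 = 1`. Then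
everything else is forced: `θ_g(y) = u_g y u_g⁻¹`, `w_{g,h} = u_g u_h u_{gh}⁻¹`, and `a δ_g ↦ a u_g`
is the isomorphism from the crossed product onto `FMat_X(B)`.

The `u_g` come from a stable triviality argument for Morita contexts. Let `M = B_g`, `N = B_{g⁻¹}`.
An idempotent local unit `e` of `M N` has the form `e = ∑ (e a_i)(b_i e)` with `a_i ∈ M`, `b_i ∈ N`.
Such "frames" make `M N` a retract of a sum of copies of `M`, and the frames of `N M` make `M` a
retract of a sum of copies of `M N`. An Eilenberg swindle then yields an isomorphism of the sums of
`X` copies (`pairingEquiv_of_retracts`). The argument is run for pairings such as `M × N → B`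
instead of modules, so that every map comes with an adjoint: the isomorphism `R` acts on the rows of
matrices, its adjoint `L` on the columns, and adjointness reads `(x u) n = x (u n)`
(`FMat.exists_isTrivialization_component`).

No algebra containing `u_g` is constructed. It is represented by the maps `r g : x ↦ x u_g` and `t g
: y ↦ u_g y u_g⁻¹`, and `x u_g u_h` by a relation. Identities are proved by multiplying with a
suitable `u_g` on the right and using that `r g` is injective. Local units make these products
meaningful and turn products of the ideals `D_g` into intersections. -/

noncomputable section

/-! ### Pairings with adjoint maps, and the Eilenberg swindle -/

section Pairings

variable {k V : Type*} [CommRing k] [AddCommGroup V] [Module k V]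
variable {S S' T T' U U' : Type*}
  [AddCommGroup S] [Module k S] [AddCommGroup S'] [Module k S']
  [AddCommGroup T] [Module k T] [AddCommGroup T'] [Module k T']
  [AddCommGroup U] [Module k U] [AddCommGroup U'] [Module k U']

/-- Two pairings are equivalent if they are intertwined by a pair of mutually adjoint
isomorphisms. -/
def PairingEquiv (β : S →ₗ[k] S' →ₗ[k] V) (γ : T →ₗ[k] T' →ₗ[k] V) : Prop :=
  ∃ (R : S ≃ₗ[k] T) (L : T' ≃ₗ[k] S'), ∀ s t', γ (R s) t' = β s (L t')

/-- A pairing is a retract of another one, by means of maps that have adjoints. -/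
def PairingRetract (β : S →ₗ[k] S' →ₗ[k] V) (γ : T →ₗ[k] T' →ₗ[k] V) : Prop :=
  ∃ (r : S →ₗ[k] T) (r' : T' →ₗ[k] S') (c : T →ₗ[k] S) (c' : S' →ₗ[k] T'),
    (∀ s t', γ (r s) t' = β s (r' t')) ∧ (∀ t s', β (c t) s' = γ t (c' s')) ∧
    (∀ s, c (r s) = s) ∧ (∀ s', r' (c' s') = s')

namespace PairingEquiv

variable {β : S →ₗ[k] S' →ₗ[k] V} {γ : T →ₗ[k] T' →ₗ[k] V} {ε : U →ₗ[k] U' →ₗ[k] V}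

theorem symm (h : PairingEquiv β γ) : PairingEquiv γ β := by
  obtain ⟨R, L, h⟩ := h
  exact ⟨R.symm, L.symm, fun t s' => by simpa using (h (R.symm t) (L.symm s')).symm⟩

theorem trans (h : PairingEquiv β γ) (h' : PairingEquiv γ ε) : PairingEquiv β ε := by
  obtain ⟨R, L, h⟩ := h
  obtain ⟨R', L', h'⟩ := h'
  exact ⟨R.trans R', L'.trans L, fun s t => by simp [h, h']⟩

end PairingEquiv

theorem PairingRetract.trans_equiv {β : S →ₗ[k] S' →ₗ[k] V} {γ : T →ₗ[k] T' →ₗ[k] V}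
    {ε : U →ₗ[k] U' →ₗ[k] V} (h : PairingRetract β γ) (h' : PairingEquiv γ ε) :
    PairingRetract β ε := by
  obtain ⟨r, r', c, c', h1, h2, h3, h4⟩ := h
  obtain ⟨R, L, h'⟩ := h'
  refine ⟨R.toLinearMap ∘ₗ r, r' ∘ₗ L.toLinearMap, c ∘ₗ R.symm.toLinearMap,
    L.symm.toLinearMap ∘ₗ c', ?_, ?_, ?_, ?_⟩
  · intro s t'
    simp [h', h1]
  · intro t s'
    simpa [h2] using (h' (R.symm t) (L.symm (c' s'))).symm
  · intro s
    simp [h3]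
  · intro s'
    simp [h4]

/-- The sum of two pairings. -/
def sumPairing (β : S →ₗ[k] S' →ₗ[k] V) (γ : T →ₗ[k] T' →ₗ[k] V) :
    S × T →ₗ[k] S' × T' →ₗ[k] V :=
  LinearMap.coprod ((LinearMap.lcomp k V (LinearMap.fst k S' T')) ∘ₗ β)
    ((LinearMap.lcomp k V (LinearMap.snd k S' T')) ∘ₗ γ)

@[simp]
theorem sumPairing_apply (β : S →ₗ[k] S' →ₗ[k] V) (γ : T →ₗ[k] T' →ₗ[k] V) (x : S × T)
    (y : S' × T') : sumPairing β γ x y = β x.1 y.1 + γ x.2 y.2 := by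
  simp [sumPairing]

/-- The sum of copies of a pairing, indexed by `I`. -/
def powPairing (I : Type*) (β : S →ₗ[k] S' →ₗ[k] V) : (I →₀ S) →ₗ[k] (I →₀ S') →ₗ[k] V :=
  Finsupp.lsum k fun i => (LinearMap.lcomp k V (Finsupp.lapply i)) ∘ₗ β

theorem powPairing_apply {I : Type*} (β : S →ₗ[k] S' →ₗ[k] V) (x : I →₀ S) (y : I →₀ S') :
    powPairing I β x y = x.sum fun i s => β s (y i) := by
  simp [powPairing, Finsupp.sum, LinearMap.sum_apply]

@[simp]
theorem powPairing_single_left {I : Type*} (β : S →ₗ[k] S' →ₗ[k] V) (i : I) (s : S)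
    (y : I →₀ S') : powPairing I β (Finsupp.single i s) y = β s (y i) := by
  simp [powPairing]

theorem powPairing_single_right {I : Type*} (β : S →ₗ[k] S' →ₗ[k] V) (x : I →₀ S) (i : I)
    (s' : S') : powPairing I β x (Finsupp.single i s') = β (x i) s' := by
  classical
  induction x using Finsupp.induction_linear with
  | zero => simp
  | add x y hx hy => simp [hx, hy]
  | single j s =>
    rw [powPairing_single_left]
    by_cases h : i = j
    · subst h; simp
    · simp [h, Ne.symm h]

theorem powPairing_reindex {I J : Type*} (e : I ≃ J) (β : S →ₗ[k] S' →ₗ[k] V) :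
    PairingEquiv (powPairing I β) (powPairing J β) := by
  refine ⟨Finsupp.domLCongr e, Finsupp.domLCongr e.symm, fun x y => ?_⟩
  induction x using Finsupp.induction_linear with
  | zero => simp only [map_zero, LinearMap.zero_apply]
  | add x y hx hy => simp only [map_add, LinearMap.add_apply, hx, hy]
  | single j s => simp [Finsupp.domLCongr_apply]

theorem powPairing_powPairing {I J : Type*} (β : S →ₗ[k] S' →ₗ[k] V) :
    PairingEquiv (powPairing I (powPairing J β)) (powPairing (I × J) β) := by
  refine ⟨(Finsupp.curryLinearEquiv k).symm, Finsupp.curryLinearEquiv k, fun x y => ?_⟩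
  induction x using Finsupp.induction_linear with
  | zero => simp only [map_zero, LinearMap.zero_apply]
  | add x y hx hy => simp only [map_add, LinearMap.add_apply, hx, hy]
  | single i s =>
    induction s using Finsupp.induction_linear with
    | zero => simp only [map_zero, LinearMap.zero_apply, Finsupp.single_zero]
    | add x y hx hy =>
      simp only [Finsupp.single_add, map_add, LinearMap.add_apply, hx, hy]
    | single j s => simp [Finsupp.curryLinearEquiv]

theorem PairingRetract.pow (I : Type*) {β : S →ₗ[k] S' →ₗ[k] V} {γ : T →ₗ[k] T' →ₗ[k] V}
    (h : PairingRetract β γ) : PairingRetract (powPairing I β) (powPairing I γ) := by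
  obtain ⟨r, r', c, c', h1, h2, h3, h4⟩ := h
  refine ⟨Finsupp.mapRange.linearMap r, Finsupp.mapRange.linearMap r',
    Finsupp.mapRange.linearMap c, Finsupp.mapRange.linearMap c', ?_, ?_, ?_, ?_⟩
  · intro s t'
    induction s using Finsupp.induction_linear with
    | zero => simp
    | add x y hx hy => simp only [map_add, LinearMap.add_apply, hx, hy]
    | single i s => simp [h1]
  · intro s t'
    induction s using Finsupp.induction_linear with
    | zero => simp
    | add x y hx hy => simp only [map_add, LinearMap.add_apply, hx, hy]
    | single i s => simp [h2]
  · intro s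
    ext i
    simp [h3]
  · intro s
    ext i
    simp [h4]

/-- The map `S ⊕ T^ℕ → T^ℕ` of the Eilenberg swindle for a retract `S` of `T`. -/
def swindleMap (r : S →ₗ[k] T) (c : T →ₗ[k] S) : S × (ℕ →₀ T) →ₗ[k] ℕ →₀ T :=
  -- If `c ∘ r = id` then `T = r(S) ⊕ ker c`. The parts in `ker c` stay in place and the parts in
  -- `r(S)` move up by one position, which leaves room for `S` at position `0`.
  LinearMap.coprod (Finsupp.lsingle 0 ∘ₗ r)
    (Finsupp.mapRange.linearMap (LinearMap.id - r ∘ₗ c) +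
      Finsupp.lmapDomain T k Nat.succ ∘ₗ Finsupp.mapRange.linearMap (r ∘ₗ c))

/-- The inverse of `swindleMap`. -/
def swindleInv (r : S →ₗ[k] T) (c : T →ₗ[k] S) : (ℕ →₀ T) →ₗ[k] S × (ℕ →₀ T) :=
  LinearMap.prod (c ∘ₗ Finsupp.lapply 0)
    (Finsupp.mapRange.linearMap (LinearMap.id - r ∘ₗ c) +
      Finsupp.mapRange.linearMap (r ∘ₗ c) ∘ₗ Finsupp.lcomapDomain Nat.succ Nat.succ_injective)

theorem swindleMap_zero (r : S →ₗ[k] T) (c : T →ₗ[k] S) (x : S × (ℕ →₀ T)) :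
    swindleMap r c x 0 = r x.1 + (x.2 0 - r (c (x.2 0))) := by
  have : Finsupp.mapDomain Nat.succ (Finsupp.mapRange (r ∘ c) (by simp) x.2) 0 = 0 :=
    Finsupp.mapDomain_of_notMem_range _ _ (by simp)
  simpa [swindleMap] using this

theorem swindleMap_succ (r : S →ₗ[k] T) (c : T →ₗ[k] S) (x : S × (ℕ →₀ T)) (n : ℕ) :
    swindleMap r c x (n + 1) = (x.2 (n + 1) - r (c (x.2 (n + 1)))) + r (c (x.2 n)) := by
  have := Finsupp.mapDomain_apply Nat.succ_injective
    (Finsupp.mapRange (r ∘ c) (by simp) x.2) n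
  simpa [swindleMap] using this

theorem swindleInv_fst (r : S →ₗ[k] T) (c : T →ₗ[k] S) (x : ℕ →₀ T) :
    (swindleInv r c x).1 = c (x 0) := rfl

theorem swindleInv_snd (r : S →ₗ[k] T) (c : T →ₗ[k] S) (x : ℕ →₀ T) (n : ℕ) :
    (swindleInv r c x).2 n = (x n - r (c (x n))) + r (c (x (n + 1))) := rfl

/-- The Eilenberg swindle: if `S` is a retract of `T` then `S ⊕ T^ℕ ≃ T^ℕ`. -/
def swindle (r : S →ₗ[k] T) (c : T →ₗ[k] S) (h : ∀ s, c (r s) = s) :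
    (S × (ℕ →₀ T)) ≃ₗ[k] (ℕ →₀ T) :=
  LinearEquiv.ofLinearMap (swindleMap r c) (swindleInv r c)
    (by
      refine LinearMap.ext fun x => Finsupp.ext fun n => ?_
      rcases n with _ | n <;>
        simp [swindleMap_zero, swindleMap_succ, swindleInv_fst, swindleInv_snd, h])
    (by
      refine LinearMap.ext fun x => Prod.ext ?_ (Finsupp.ext fun n => ?_)
      · simp [swindleMap_zero, swindleInv_fst, h]
      · rcases n with _ | n <;>
          simp [swindleMap_zero, swindleMap_succ, swindleInv_snd, h])

/-- The idempotents `r ∘ c` on `T` and `c' ∘ r'` on `T'` are adjoint, so shifting one summand up on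
the left is adjoint to shifting the other one down on the right. Hence the adjoint of the swindle
for `(r, c)` is the inverse swindle for `(c', r')`. -/
theorem swindle_pairing {β : S →ₗ[k] S' →ₗ[k] V} {γ : T →ₗ[k] T' →ₗ[k] V}
    (h : PairingRetract β γ) :
    PairingEquiv (sumPairing β (powPairing ℕ γ)) (powPairing ℕ γ) := by
  obtain ⟨r, r', c, c', h1, h2, h3, h4⟩ := h
  refine ⟨swindle r c h3, (swindle c' r' h4).symm, fun x y => ?_⟩
  change powPairing ℕ γ (swindleMap r c x) y = sumPairing β (powPairing ℕ γ) x (swindleInv c' r' y)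
  induction y using Finsupp.induction_linear with
  | zero => simp
  | add y z hy hz => simp only [map_add, hy, hz]
  | single m t' =>
    rcases m with _ | m
    · have e : swindleInv c' r' (Finsupp.single 0 t') =
          (r' t', Finsupp.single 0 (t' - c' (r' t'))) := by
        refine Prod.ext ?_ (Finsupp.ext fun n => ?_)
        · simp [swindleInv_fst]
        · rcases n with _ | n <;> simp [swindleInv_snd]
      simp [e, powPairing_single_right, swindleMap_zero, h1, h2]
    · have e : swindleInv c' r' (Finsupp.single (m + 1) t') =
          (0, Finsupp.single (m + 1) (t' - c' (r' t')) + Finsupp.single m (c' (r' t'))) := by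
        refine Prod.ext ?_ (Finsupp.ext fun n => ?_)
        · simp [swindleInv_fst]
        · by_cases hn : n = m + 1
          · subst hn
            simp [swindleInv_snd]
          · by_cases hm : n = m
            · subst hm
              simp [swindleInv_snd]
            · simp [swindleInv_snd, hn, hm]
      simp [e, powPairing_single_right, swindleMap_succ, h1, h2]

theorem sumPairing_comm (β : S →ₗ[k] S' →ₗ[k] V) (γ : T →ₗ[k] T' →ₗ[k] V) :
    PairingEquiv (sumPairing β γ) (sumPairing γ β) :=
  ⟨LinearEquiv.prodComm k S T, LinearEquiv.prodComm k T' S', fun s t' => by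
    simp [add_comm]⟩

theorem PairingEquiv.sum_right {γ : T →ₗ[k] T' →ₗ[k] V} {ε : U →ₗ[k] U' →ₗ[k] V}
    (β : S →ₗ[k] S' →ₗ[k] V) (h : PairingEquiv γ ε) :
    PairingEquiv (sumPairing β γ) (sumPairing β ε) := by
  obtain ⟨R, L, h⟩ := h
  exact ⟨(LinearEquiv.refl k S).prodCongr R, (LinearEquiv.refl k S').prodCongr L, fun s t' => by
    simp [h]⟩

/-- Since `X × X ≃ X`, the sum `β^X` is a retract of `γ^X`. The swindle needs `ℕ` copies of `γ^X`,
and `ℕ × X ≃ X` shows that these amount to `γ^X` itself. -/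
theorem PairingRetract.absorb {X : Type*} [Infinite X] {β : S →ₗ[k] S' →ₗ[k] V}
    {γ : T →ₗ[k] T' →ₗ[k] V} (h : PairingRetract β (powPairing X γ)) :
    PairingEquiv (sumPairing (powPairing X β) (powPairing X γ)) (powPairing X γ) := by
  obtain ⟨e⟩ : Nonempty (X × X ≃ X) := Cardinal.eq.1 (by simp)
  obtain ⟨e'⟩ : Nonempty (ℕ × X ≃ X) := by
    refine Cardinal.lift_mk_eq'.1 ?_
    simp [Cardinal.aleph0_mul_eq]
  have h1 : PairingRetract (powPairing X β) (powPairing X γ) :=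
    (h.pow X).trans_equiv ((powPairing_powPairing γ).trans (powPairing_reindex e γ))
  have h2 : PairingEquiv (powPairing ℕ (powPairing X γ)) (powPairing X γ) :=
    (powPairing_powPairing γ).trans (powPairing_reindex e' γ)
  exact ((h2.symm.sum_right _).trans (swindle_pairing h1)).trans h2

/-- Two pairings, each of which is a retract of a sum of copies of the other one, become
equivalent after passing to sums of sufficiently many copies. -/
theorem pairingEquiv_of_retracts {X : Type*} [Infinite X] {β : S →ₗ[k] S' →ₗ[k] V}
    {γ : T →ₗ[k] T' →ₗ[k] V} (h : PairingRetract β (powPairing X γ))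
    (h' : PairingRetract γ (powPairing X β)) :
    PairingEquiv (powPairing X β) (powPairing X γ) :=
  -- Each of the two sums absorbs the other, so both are equivalent to `β^X ⊕ γ^X`.
  h'.absorb.symm.trans ((sumPairing_comm _ _).trans h.absorb)

end Pairings

end

noncomputable section

/-! ### Orthogonal local units and frames -/

section LocalUnits

variable {k B : Type*} [CommRing k] [NonUnitalRing B] [Module k B]

/-- `E` is a set of orthogonal local units of the submodule `D`. -/
structure IsOrthogonalUnitSet (D : Submodule k B) (E : Set B) : Prop where
  subset : ∀ e ∈ E, e ∈ D
  idem : ∀ e ∈ E, e * e = e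
  orthogonal : ∀ e ∈ E, ∀ f ∈ E, e ≠ f → e * f = 0
  right : ∀ x ∈ D, ∃ F : Finset B, ↑F ⊆ E ∧ ∑ e ∈ F, x * e = x ∧ ∀ e ∈ E, e ∉ F → x * e = 0
  left : ∀ x ∈ D, ∃ F : Finset B, ↑F ⊆ E ∧ ∑ e ∈ F, e * x = x ∧ ∀ e ∈ E, e ∉ F → e * x = 0

/-- The `f e` are pairwise orthogonal projections, so an element of the sum of their images is the
finite sum of its projections. With `f e` the right or the left multiplication by `e`, this serves
both decompositions of an algebra with orthogonal local units. -/
theorem exists_finset_of_mem_iSup_range {V : Type*} [AddCommGroup V] [Module k V] {E : Set V}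
    {f : V → V →ₗ[k] V} (idem : ∀ e ∈ E, ∀ x, f e (f e x) = f e x)
    (orthogonal : ∀ e ∈ E, ∀ e' ∈ E, e ≠ e' → ∀ x, f e' (f e x) = 0) {x : V}
    (hx : x ∈ ⨆ e : E, LinearMap.range (f e)) :
    ∃ F : Finset V, ↑F ⊆ E ∧ ∑ e ∈ F, f e x = x ∧ ∀ e ∈ E, e ∉ F → f e x = 0 := by
  classical
  induction hx using Submodule.iSup_induction' with
  | mem e x hx =>
    obtain ⟨y, rfl⟩ := hx
    refine ⟨{e.1}, by simp, by simp [idem e.1 e.2], fun e' he' hne => ?_⟩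
    exact orthogonal e.1 e.2 e' he' (fun h => hne (by simp [h])) y
  | zero => exact ⟨∅, by simp, by simp, by simp⟩
  | add x y hx hy hx' hy' =>
    obtain ⟨F, hF, hF1, hF2⟩ := hx'
    obtain ⟨F', hF', hF1', hF2'⟩ := hy'
    have hsub : ∀ e ∈ F ∪ F', e ∈ E := fun e he =>
      (Finset.mem_union.1 he).elim (fun h => hF h) (fun h => hF' h)
    refine ⟨F ∪ F', hsub, ?_, fun e he hne => ?_⟩
    · have a1 : ∑ e ∈ F ∪ F', f e x = x := by
        rw [← Finset.sum_subset (Finset.subset_union_left (s₁ := F) (s₂ := F')), hF1]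
        exact fun e he he' => hF2 e (hsub e he) he'
      have a2 : ∑ e ∈ F ∪ F', f e y = y := by
        rw [← Finset.sum_subset (Finset.subset_union_right (s₁ := F) (s₂ := F')), hF1']
        exact fun e he he' => hF2' e (hsub e he) he'
      simp only [map_add, Finset.sum_add_distrib, a1, a2]
    · rw [Finset.mem_union, not_or] at hne
      rw [map_add, hF2 e he hne.1, hF2' e he hne.2, add_zero]

/-- Every finite subset of `D` has a common two-sided unit in `D`. -/
def HasCommonUnits (D : Submodule k B) : Prop :=
  ∀ s : Finset B, (∀ x ∈ s, x ∈ D) → ∃ e ∈ D, ∀ x ∈ s, e * x = x ∧ x * e = x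

theorem HasCommonUnits.pair {D : Submodule k B} (h : HasCommonUnits D) {x y : B} (hx : x ∈ D)
    (hy : y ∈ D) : ∃ e ∈ D, e * x = x ∧ x * e = x ∧ e * y = y ∧ y * e = y := by
  classical
  obtain ⟨e, he, h'⟩ := h {x, y} (by simp [hx, hy])
  exact ⟨e, he, (h' x (by simp)).1, (h' x (by simp)).2, (h' y (by simp)).1, (h' y (by simp)).2⟩

theorem HasCommonUnits.single {D : Submodule k B} (h : HasCommonUnits D) {x : B} (hx : x ∈ D) :
    ∃ e ∈ D, e * x = x ∧ x * e = x := by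
  obtain ⟨e, he, h1, h2, -⟩ := h.pair hx hx
  exact ⟨e, he, h1, h2⟩

/-- The sum of the finitely many idempotents needed for some element of `s`, on either side, is a
unit for all of them: the additional summands annihilate. -/
theorem IsOrthogonalUnitSet.hasCommonUnits {D : Submodule k B} {E : Set B}
    (h : IsOrthogonalUnitSet D E) : HasCommonUnits D := by
  classical
  intro s hs
  choose! F hF hF1 hF2 using h.right
  choose! F' hF' hF1' hF2' using h.left
  have hsub : ∀ e ∈ s.biUnion fun x => F x ∪ F' x, e ∈ E := by
    intro e he
    obtain ⟨x, hx, he⟩ := Finset.mem_biUnion.1 he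
    rcases Finset.mem_union.1 he with he | he
    · exact hF x (hs x hx) he
    · exact hF' x (hs x hx) he
  refine ⟨∑ e ∈ s.biUnion fun x => F x ∪ F' x, e,
    D.sum_mem fun e he => h.subset e (hsub e he), fun x hx => ⟨?_, ?_⟩⟩
  · rw [Finset.sum_mul, ← Finset.sum_subset (s₁ := F' x), hF1' x (hs x hx)]
    · exact Finset.subset_union_right.trans
        (Finset.subset_biUnion_of_mem (fun x => F x ∪ F' x) hx)
    · exact fun e he hne => hF2' x (hs x hx) e (hsub e he) hne
  · rw [Finset.mul_sum, ← Finset.sum_subset (s₁ := F x), hF1 x (hs x hx)]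
    · exact Finset.subset_union_left.trans (Finset.subset_biUnion_of_mem (fun x => F x ∪ F' x) hx)
    · exact fun e he hne => hF2 x (hs x hx) e (hsub e he) hne

variable [IsScalarTower k B B] [SMulCommClass k B B]

theorem HasOrthogonalLocalUnits.exists_isOrthogonalUnitSet {D : NonUnitalSubalgebra k B}
    (h : HasOrthogonalLocalUnits k D) :
    ∃ E : Set B, IsOrthogonalUnitSet D.toSubmodule E := by
  obtain ⟨E, h1, h2, h3, h4⟩ := h
  have h3 := @DirectSum.IsInternal.submodule_iSup_eq_top _ _ _ (_) _ _ _ _ h3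
  have h4 := @DirectSum.IsInternal.submodule_iSup_eq_top _ _ _ (_) _ _ _ _ h4
  have right (x : D) := exists_finset_of_mem_iSup_range (f := LinearMap.mulRight k)
    (fun e he x => by simp [mul_assoc, h1 e he])
    (fun e he e' he' hne x => by simp [mul_assoc, h2 e he e' he' hne]) (x := x) (by rw [h3]; trivial)
  have left (x : D) := exists_finset_of_mem_iSup_range (f := LinearMap.mulLeft k)
    (fun e he x => by simp [← mul_assoc, h1 e he])
    (fun e he e' he' hne x => by simp [← mul_assoc, h2 e' he' e he hne.symm]) (x := x)
    (by rw [h4]; trivial)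
  refine ⟨Subtype.val '' E, ?_, ?_, ?_, ?_, ?_⟩
  · rintro _ ⟨e, -, rfl⟩
    exact e.2
  · rintro _ ⟨e, he, rfl⟩
    exact congrArg Subtype.val (h1 e he)
  · rintro _ ⟨e, he, rfl⟩ _ ⟨f, hf, rfl⟩ hne
    exact congrArg Subtype.val (h2 e he f hf (fun h => hne (by rw [h])))
  · intro x hx
    obtain ⟨F, hF, hF1, hF2⟩ := right ⟨x, hx⟩
    refine ⟨F.map (Function.Embedding.subtype _), ?_, ?_, ?_⟩
    · rw [Finset.coe_map]
      exact Set.image_mono hF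
    · rw [Finset.sum_map]
      simpa using congrArg Subtype.val hF1
    · rintro _ ⟨e, he, rfl⟩ hne
      refine congrArg Subtype.val (hF2 e he fun h => hne ?_)
      simpa using h
  · intro x hx
    obtain ⟨F, hF, hF1, hF2⟩ := left ⟨x, hx⟩
    refine ⟨F.map (Function.Embedding.subtype _), ?_, ?_, ?_⟩
    · rw [Finset.coe_map]
      exact Set.image_mono hF
    · rw [Finset.sum_map]
      simpa using congrArg Subtype.val hF1
    · rintro _ ⟨e, he, rfl⟩ hne
      refine congrArg Subtype.val (hF2 e he fun h => hne ?_)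
      simpa using h

theorem spanMul_induction {S T : Submodule k B} {p : B → Prop} {x : B} (hx : x ∈ S ⊙ T)
    (mul : ∀ s ∈ S, ∀ t ∈ T, p (s * t)) (add : ∀ x y, p x → p y → p (x + y)) : p x := by
  -- Only additivity of `p` is assumed. Proving the claim for all multiples of `x` lets the scalars
  -- be absorbed into the left factors.
  have key : ∀ c : k, p (c • x) := by
    rw [spanMul, Submodule.map₂_eq_span_image2] at hx
    induction hx using Submodule.span_induction with
    | mem x hx =>
      obtain ⟨s, hs, t, ht, rfl⟩ := hx
      intro c
      change p (c • (s * t))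
      rw [← smul_mul_assoc]
      exact mul _ (S.smul_mem c hs) t ht
    | zero => simpa using mul 0 S.zero_mem 0 T.zero_mem
    | add x y _ _ hx hy => intro c; rw [smul_add]; exact add _ _ (hx c) (hy c)
    | smul a x _ hx => intro c; rw [smul_smul]; exact hx _
  simpa using key 1

/-- If `x e = x` and `y f = y`, then a common unit `d` of `e` and `f` satisfies `x d = x e d = x`
and likewise `y d = y`. -/
theorem HasCommonUnits.exists_right_unit {S D : Submodule k B} (h : HasCommonUnits D) {x : B}
    (hx : x ∈ S ⊙ D) : ∃ e ∈ D, x * e = x := by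
  refine spanMul_induction (p := fun x => ∃ e ∈ D, x * e = x) hx ?_ ?_
  · intro s hs t ht
    obtain ⟨e, he, -, h2⟩ := h.single ht
    exact ⟨e, he, by rw [mul_assoc, h2]⟩
  · intro x y hx hy
    obtain ⟨e, he, hx⟩ := hx
    obtain ⟨f, hf, hy⟩ := hy
    obtain ⟨d, hd, h1, h2, h3, h4⟩ := h.pair he hf
    refine ⟨d, hd, ?_⟩
    rw [add_mul, ← hx, ← hy, mul_assoc, mul_assoc, h2, h4]

theorem HasCommonUnits.exists_left_unit {S D : Submodule k B} (h : HasCommonUnits D) {x : B}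
    (hx : x ∈ D ⊙ S) : ∃ e ∈ D, e * x = x := by
  refine spanMul_induction (p := fun x => ∃ e ∈ D, e * x = x) hx ?_ ?_
  · intro s hs t ht
    obtain ⟨e, he, h2, -⟩ := h.single hs
    exact ⟨e, he, by rw [← mul_assoc, h2]⟩
  · intro x y hx hy
    obtain ⟨e, he, hx⟩ := hx
    obtain ⟨f, hf, hy⟩ := hy
    obtain ⟨d, hd, h1, h2, h3, h4⟩ := h.pair he hf
    refine ⟨d, hd, ?_⟩
    rw [mul_add, ← hx, ← hy, ← mul_assoc, ← mul_assoc, h1, h3]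

theorem exists_sum_of_mem_spanMul {M N : Submodule k B} {x : B} (hx : x ∈ M ⊙ N) :
    ∃ (n : ℕ) (a b : ℕ → B), (∀ i, a i ∈ M) ∧ (∀ i, b i ∈ N) ∧
      ∑ i ∈ Finset.range n, a i * b i = x := by
  refine spanMul_induction (p := fun x => ∃ (n : ℕ) (a b : ℕ → B), (∀ i, a i ∈ M) ∧ (∀ i, b i ∈ N) ∧
    ∑ i ∈ Finset.range n, a i * b i = x) hx ?_ ?_
  · intro s hs t ht
    exact ⟨1, fun _ => s, fun _ => t, fun _ => hs, fun _ => ht, by simp⟩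
  · intro x y hx hy
    obtain ⟨n, a, b, ha, hb, hx⟩ := hx
    obtain ⟨n', a', b', ha', hb', hy⟩ := hy
    refine ⟨n + n', fun i => if i < n then a i else a' (i - n),
      fun i => if i < n then b i else b' (i - n), ?_, ?_, ?_⟩
    · intro i; dsimp only; split_ifs; exacts [ha _, ha' _]
    · intro i; dsimp only; split_ifs; exacts [hb _, hb' _]
    · rw [Finset.sum_range_add]
      congr 1
      · rw [← hx]
        refine Finset.sum_congr rfl fun i hi => ?_
        simp [Finset.mem_range.1 hi]
      · rw [← hy]
        refine Finset.sum_congr rfl fun i hi => ?_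
        simp

/-- Families `r` in `M` and `c` in `N` such that `∑ r j * c j` is a unit of `D`. -/
structure IsFrame {X : Type*} (D M N : Submodule k B) (r c : X → B) : Prop where
  mem_left : ∀ j, r j ∈ M
  mem_right : ∀ j, c j ∈ N
  right : ∀ x, (∃ d ∈ D, x * d = x) →
    ∃ S : Finset X, (∀ j ∉ S, x * r j = 0) ∧ ∑ j ∈ S, x * r j * c j = x
  left : ∀ x, (∃ d ∈ D, d * x = x) →
    ∃ S : Finset X, (∀ j ∉ S, c j * x = 0) ∧ ∑ j ∈ S, r j * (c j * x) = x

/-- From `e = ∑ a_i b_i` and `e = e e e` one gets `e = ∑ (e a_i)(b_i e)`; the frame consists of all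
`e a_i` and `b_i e`. It is locally finite because an element with a unit in `D` is annihilated by
almost all `e ∈ E`. Padding with zeros makes `B × ℕ` the index set whatever `E` and the numbers of
summands are, so that the same `X` serves all `g ∈ G`. -/
theorem IsOrthogonalUnitSet.exists_isFrame {D M N : Submodule k B} {E : Set B}
    (h : IsOrthogonalUnitSet D E) (hD : D = M ⊙ N) (hM : D ⊙ M ≤ M) (hN : N ⊙ D ≤ N) :
    ∃ r c : B × ℕ → B, IsFrame D M N r c := by
  classical
  have key : ∀ e : B, ∃ (n : ℕ) (a b : ℕ → B), (∀ i, a i ∈ M) ∧ (∀ i, b i ∈ N) ∧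
      (e ∈ E → ∑ i ∈ Finset.range n, e * a i * (b i * e) = e) := by
    intro e
    by_cases he : e ∈ E
    · have hx := h.subset e he
      rw [hD] at hx
      obtain ⟨n, a, b, ha, hb, hs⟩ := exists_sum_of_mem_spanMul hx
      refine ⟨n, a, b, ha, hb, fun _ => ?_⟩
      calc _ = e * (∑ i ∈ Finset.range n, a i * b i) * e := by
            simp only [Finset.mul_sum, Finset.sum_mul, mul_assoc]
        _ = e := by rw [hs, h.idem e he, h.idem e he]
    · exact ⟨0, 0, 0, fun _ => M.zero_mem, fun _ => N.zero_mem, fun h => absurd h he⟩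
  choose n a b ha hb hab using key
  -- Here `x` need not lie in `D`; as `x e = x (d e)`, the finite set of idempotents belonging to
  -- `d` works for `x`.
  have hr : ∀ x, (∃ d ∈ D, x * d = x) → ∃ F : Finset B, ↑F ⊆ E ∧ ∑ e ∈ F, x * e = x ∧
      ∀ e ∈ E, e ∉ F → x * e = 0 := by
    rintro x ⟨d, hd, hx⟩
    obtain ⟨F, hF, hF1, hF2⟩ := h.right d hd
    refine ⟨F, hF, ?_, fun e he hne => ?_⟩
    · rw [← Finset.mul_sum]
      nth_rw 1 [← hx]
      rw [mul_assoc, Finset.mul_sum, hF1, hx]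
    · rw [← hx, mul_assoc, hF2 e he hne, mul_zero]
  have hl : ∀ x, (∃ d ∈ D, d * x = x) → ∃ F : Finset B, ↑F ⊆ E ∧ ∑ e ∈ F, e * x = x ∧
      ∀ e ∈ E, e ∉ F → e * x = 0 := by
    rintro x ⟨d, hd, hx⟩
    obtain ⟨F, hF, hF1, hF2⟩ := h.left d hd
    refine ⟨F, hF, ?_, fun e he hne => ?_⟩
    · rw [← Finset.sum_mul]
      nth_rw 1 [← hx]
      rw [← mul_assoc, Finset.sum_mul, hF1, hx]
    · rw [← hx, ← mul_assoc, hF2 e he hne, zero_mul]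
  have hsum : ∀ (F : Finset B) (f : B × ℕ → B),
      ∑ j ∈ (F.sigma fun e => Finset.range (n e)).map (Equiv.sigmaEquivProd B ℕ).toEmbedding, f j =
        ∑ e ∈ F, ∑ i ∈ Finset.range (n e), f (e, i) := by
    intro F f
    rw [Finset.sum_map, Finset.sum_sigma]
    rfl
  have hmem : ∀ (F : Finset B) (j : B × ℕ),
      j ∉ (F.sigma fun e => Finset.range (n e)).map (Equiv.sigmaEquivProd B ℕ).toEmbedding →
        j.1 ∈ F → ¬ j.2 < n j.1 := by
    intro F j hj h1 h2
    exact hj (Finset.mem_map.2 ⟨⟨j.1, j.2⟩, by simp [h1, h2], rfl⟩)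
  refine ⟨fun j => if j.1 ∈ E ∧ j.2 < n j.1 then j.1 * a j.1 j.2 else 0,
    fun j => if j.1 ∈ E ∧ j.2 < n j.1 then b j.1 j.2 * j.1 else 0, ?_, ?_, ?_, ?_⟩
  · intro j
    split_ifs with hj
    · exact hM (mul_mem_spanMul (h.subset _ hj.1) (ha _ _))
    · exact M.zero_mem
  · intro j
    split_ifs with hj
    · exact hN (mul_mem_spanMul (hb _ _) (h.subset _ hj.1))
    · exact N.zero_mem
  · intro x hx
    obtain ⟨F, hF, hF1, hF2⟩ := hr x hx
    refine ⟨(F.sigma fun e => Finset.range (n e)).map (Equiv.sigmaEquivProd B ℕ).toEmbedding,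
      fun j hj => ?_, ?_⟩
    rotate_left
    · rw [hsum F]
      refine Eq.trans (Finset.sum_congr rfl fun e he => ?_) hF1
      have he' := hF he
      rw [← hab e he', Finset.mul_sum, hab e he']
      refine Finset.sum_congr rfl fun i hi => ?_
      simp [he', Finset.mem_range.1 hi, mul_assoc]
    · split_ifs with h'
      · rw [← mul_assoc, hF2 _ h'.1 fun h'' => hmem F j hj h'' h'.2, zero_mul]
      · rw [mul_zero]
  · intro x hx
    obtain ⟨F, hF, hF1, hF2⟩ := hl x hx
    refine ⟨(F.sigma fun e => Finset.range (n e)).map (Equiv.sigmaEquivProd B ℕ).toEmbedding,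
      fun j hj => ?_, ?_⟩
    rotate_left
    · rw [hsum F]
      refine Eq.trans (Finset.sum_congr rfl fun e he => ?_) hF1
      have he' := hF he
      rw [← hab e he', Finset.sum_mul, hab e he']
      refine Finset.sum_congr rfl fun i hi => ?_
      simp [he', Finset.mem_range.1 hi, mul_assoc]
    · split_ifs with h'
      · rw [mul_assoc, hF2 _ h'.1 fun h'' => hmem F j hj h'' h'.2, mul_zero]
      · rw [zero_mul]

end LocalUnits
end

noncomputable section

/-! ### From frames to equivalent pairings -/

section Frames

variable {k B : Type*} [CommRing k] [NonUnitalRing B] [Module k B]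

theorem coe_finsupp_lsum {X : Type*} {S T : Submodule k B} (f : X → T →ₗ[k] S) (x : X →₀ T) :
    (Finsupp.lsum k f x : B) = x.sum fun j t => (f j t : B) := by
  rw [Finsupp.lsum_apply, Finsupp.sum, AddSubmonoidClass.coe_finsetSum]
  rfl

/-- The row `(s * r j)_j`, for families `r` that are locally finite on `S`. -/
def mulRow [IsScalarTower k B B] {X : Type*} (S T : Submodule k B) (r : X → B)
    (hfin : ∀ s ∈ S, ∃ F : Finset X, ∀ j ∉ F, s * r j = 0) (hT : ∀ s ∈ S, ∀ j, s * r j ∈ T) :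
    S →ₗ[k] X →₀ T where
  toFun s := Finsupp.onFinset (hfin s s.2).choose (fun j => ⟨s * r j, hT s s.2 j⟩) (fun j hj => by
    by_contra h
    exact hj (Subtype.ext ((hfin s s.2).choose_spec j h)))
  map_add' s t := by
    ext j
    simp [add_mul]
  map_smul' a s := by
    ext j
    simp [smul_mul_assoc]

@[simp]
theorem mulRow_apply [IsScalarTower k B B] {X : Type*} (S T : Submodule k B) (r : X → B)
    (hfin : ∀ s ∈ S, ∃ F : Finset X, ∀ j ∉ F, s * r j = 0) (hT : ∀ s ∈ S, ∀ j, s * r j ∈ T)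
    (s : S) (j : X) : (mulRow S T r hfin hT s j : B) = s * r j := rfl

/-- The column `(c j * s)_j`, for families `c` that are locally finite on `S`. -/
def mulCol [SMulCommClass k B B] {X : Type*} (S T : Submodule k B) (c : X → B)
    (hfin : ∀ s ∈ S, ∃ F : Finset X, ∀ j ∉ F, c j * s = 0) (hT : ∀ s ∈ S, ∀ j, c j * s ∈ T) :
    S →ₗ[k] X →₀ T where
  toFun s := Finsupp.onFinset (hfin s s.2).choose (fun j => ⟨c j * s, hT s s.2 j⟩) (fun j hj => by
    by_contra h
    exact hj (Subtype.ext ((hfin s s.2).choose_spec j h)))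
  map_add' s t := by
    ext j
    simp [mul_add]
  map_smul' a s := by
    ext j
    simp [mul_smul_comm]

@[simp]
theorem mulCol_apply [SMulCommClass k B B] {X : Type*} (S T : Submodule k B) (c : X → B)
    (hfin : ∀ s ∈ S, ∃ F : Finset X, ∀ j ∉ F, c j * s = 0) (hT : ∀ s ∈ S, ∀ j, c j * s ∈ T)
    (s : S) (j : X) : (mulCol S T c hfin hT s j : B) = c j * s := rfl

variable [IsScalarTower k B B] [SMulCommClass k B B]

/-- The product of `B` as a pairing of two submodules. -/
def mulPairing (S S' : Submodule k B) : S →ₗ[k] S' →ₗ[k] B :=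
  (LinearMap.mul k B).domRestrict₁₂ S S'

@[simp]
theorem mulPairing_apply (S S' : Submodule k B) (s : S) (s' : S') :
    mulPairing S S' s s' = s * s' := rfl

/-- The maps are `s ↦ (s r_j)_j` and `(t_j) ↦ ∑ t_j c_j`, with adjoints `(t'_j) ↦ ∑ r_j t'_j` and
`s' ↦ (c_j s')_j`. Adjointness is associativity of the product, and the frame says that both
composites are identities. -/
theorem IsFrame.pairingRetract {X : Type*} {D M N S S' T T' : Submodule k B} {r c : X → B}
    (h : IsFrame D M N r c) (hS : ∀ s ∈ S, ∃ d ∈ D, s * d = s)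
    (hS' : ∀ s ∈ S', ∃ d ∈ D, d * s = s) (hSM : S ⊙ M ≤ T) (hTN : T ⊙ N ≤ S)
    (hNS : N ⊙ S' ≤ T') (hMT : M ⊙ T' ≤ S') :
    PairingRetract (mulPairing S S') (powPairing X (mulPairing T T')) := by
  have hr : ∀ s ∈ S, ∃ F : Finset X, ∀ j ∉ F, s * r j = 0 := fun s hs =>
    let ⟨F, hF, _⟩ := h.right s (hS s hs)
    ⟨F, hF⟩
  have hc : ∀ s ∈ S', ∃ F : Finset X, ∀ j ∉ F, c j * s = 0 := fun s hs =>
    let ⟨F, hF, _⟩ := h.left s (hS' s hs)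
    ⟨F, hF⟩
  let R := mulRow S T r hr fun s hs j => hSM (mul_mem_spanMul hs (h.mem_left j))
  let C := mulCol S' T' c hc fun s hs j => hNS (mul_mem_spanMul (h.mem_right j) hs)
  let R' : (X →₀ T') →ₗ[k] S' := Finsupp.lsum k fun j =>
    (LinearMap.mulLeft k (r j)).restrict fun t ht => hMT (mul_mem_spanMul (h.mem_left j) ht)
  let C' : (X →₀ T) →ₗ[k] S := Finsupp.lsum k fun j =>
    (LinearMap.mulRight k (c j)).restrict fun t ht => hTN (mul_mem_spanMul ht (h.mem_right j))
  have hR' : ∀ x, (R' x : B) = x.sum fun j t => r j * t := fun x => coe_finsupp_lsum _ x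
  have hC' : ∀ x, (C' x : B) = x.sum fun j t => t * c j := fun x => coe_finsupp_lsum _ x
  refine ⟨R, R', C', C, ?_, ?_, ?_, ?_⟩
  · intro s t
    induction t using Finsupp.induction_linear with
    | zero => simp
    | add x y hx hy => simp only [map_add, hx, hy]
    | single j t => simp [powPairing_single_right, hR', R, mul_assoc]
  · intro t s
    induction t using Finsupp.induction_linear with
    | zero => simp
    | add x y hx hy => simp only [map_add, LinearMap.add_apply, hx, hy]
    | single j t => simp [hC', C, mul_assoc]
  · intro s
    obtain ⟨F, hF, hF'⟩ := h.right s (hS s s.2)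
    refine Subtype.ext ?_
    rw [hC', Finsupp.sum_of_support_subset (s := F)]
    · simpa [R] using hF'
    · intro j hj
      by_contra h'
      exact Finsupp.mem_support_iff.1 hj (Subtype.ext (hF j h'))
    · simp
  · intro s
    obtain ⟨F, hF, hF'⟩ := h.left s (hS' s s.2)
    refine Subtype.ext ?_
    rw [hR', Finsupp.sum_of_support_subset (s := F)]
    · simpa [C] using hF'
    · intro j hj
      by_contra h'
      exact Finsupp.mem_support_iff.1 hj (Subtype.ext (hF j h'))
    · simp

/-- A frame for `M ⊙ N` makes the pairing on the left a retract of copies of the one on the right,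
and a frame for `N ⊙ M`, whose rows lie in `N` and columns in `M`, gives the converse. -/
theorem pairingEquiv_of_orthogonalUnitSets {M N : Submodule k B} {E E' : Set B}
    (hE : IsOrthogonalUnitSet (M ⊙ N) E) (hE' : IsOrthogonalUnitSet (N ⊙ M) E')
    (hM : M ⊙ N ⊙ M = M) (hN : N ⊙ M ⊙ N = N) :
    PairingEquiv (powPairing (B × ℕ) (mulPairing (M ⊙ N) (M ⊙ N)))
      (powPairing (B × ℕ) (mulPairing M N)) := by
  have hM' : M ⊙ (N ⊙ M) = M := by rw [← spanMul_assoc, hM]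
  have hN' : N ⊙ (M ⊙ N) = N := by rw [← spanMul_assoc, hN]
  obtain ⟨r, c, h⟩ := hE.exists_isFrame rfl hM.le hN'.le
  obtain ⟨r', c', h'⟩ := hE'.exists_isFrame rfl hN.le hM'.le
  refine pairingEquiv_of_retracts (h.pairingRetract ?_ ?_ hM.le le_rfl hN'.le le_rfl)
    (h'.pairingRetract ?_ ?_ le_rfl hM.le le_rfl hN'.le)
  · intro s hs
    obtain ⟨e, he, -, h⟩ := hE.hasCommonUnits.single hs
    exact ⟨e, he, h⟩
  · intro s hs
    obtain ⟨e, he, h, -⟩ := hE.hasCommonUnits.single hs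
    exact ⟨e, he, h⟩
  · intro s hs
    exact hE'.hasCommonUnits.exists_right_unit (hM'.symm ▸ hs)
  · intro s hs
    exact hE'.hasCommonUnits.exists_left_unit (hN.symm ▸ hs)

end Frames

end

noncomputable section

/-! ### Invertible multipliers between Morita equivalent ideals -/

section Trivialization

variable {k C : Type*} [CommRing k] [NonUnitalRing C] [Module k C] [IsScalarTower k C C]
  [SMulCommClass k C C]

/-- A map `r` on `M · N` (the right multiplication by an invertible multiplier `u` with
`M · N u = M`) and a map `t` on `N · M` (the conjugation with `u`). -/
structure IsTrivialization (M N : Submodule k C) (r t : C → C) : Prop where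
  r_mem : ∀ x ∈ M ⊙ N, r x ∈ M
  r_surj : ∀ m ∈ M, ∃ x ∈ M ⊙ N, r x = m
  r_inj : ∀ x ∈ M ⊙ N, ∀ y ∈ M ⊙ N, r x = r y → x = y
  r_add : ∀ x ∈ M ⊙ N, ∀ y ∈ M ⊙ N, r (x + y) = r x + r y
  r_smul : ∀ (c : k), ∀ x ∈ M ⊙ N, r (c • x) = c • r x
  r_mul : ∀ a ∈ M ⊙ N, ∀ x ∈ M ⊙ N, r (a * x) = a * r x
  t_mem : ∀ y ∈ N ⊙ M, t y ∈ M ⊙ N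
  t_surj : ∀ a ∈ M ⊙ N, ∃ y ∈ N ⊙ M, t y = a
  r_mul_t : ∀ x ∈ M ⊙ N, ∀ y ∈ N ⊙ M, r (x * t y) = r x * y

theorem IsTrivialization.id {M : Submodule k C} (hM : M ⊙ M = M) :
    IsTrivialization M M id id := by
  constructor <;> simp +contextual [hM]

/-- Read `r x` as `x u` and `l n` as `u n`, so that `adj` is `(x u) n = x (u n)`. The conjugation is
then determined by `u (n m) u⁻¹ = (u n)(m u⁻¹)`. -/
theorem exists_isTrivialization {M N : Submodule k C} (hD : HasCommonUnits (M ⊙ N))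
    (hD' : HasCommonUnits (N ⊙ M)) (hM : M ⊙ N ⊙ M = M) {r l : C → C}
    (r_mem : ∀ x ∈ M ⊙ N, r x ∈ M) (r_surj : ∀ m ∈ M, ∃ x ∈ M ⊙ N, r x = m)
    (r_inj : ∀ x ∈ M ⊙ N, ∀ y ∈ M ⊙ N, r x = r y → x = y)
    (r_add : ∀ x ∈ M ⊙ N, ∀ y ∈ M ⊙ N, r (x + y) = r x + r y)
    (r_smul : ∀ (c : k), ∀ x ∈ M ⊙ N, r (c • x) = c • r x)
    (l_mem : ∀ n ∈ N, l n ∈ M ⊙ N) (l_surj : ∀ x ∈ M ⊙ N, ∃ n ∈ N, l n = x)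
    (adj : ∀ x ∈ M ⊙ N, ∀ n ∈ N, r x * n = x * l n) :
    ∃ t, IsTrivialization M N r t := by
  classical
  have hDM : ∀ a ∈ M ⊙ N, ∀ m ∈ M, a * m ∈ M := fun a ha m hm => by
    rw [← hM]; exact mul_mem_spanMul ha hm
  have hDD : ∀ a ∈ M ⊙ N, ∀ b ∈ M ⊙ N, a * b ∈ M ⊙ N := fun a ha b hb => by
    have : a * b ∈ M ⊙ N ⊙ (M ⊙ N) := mul_mem_spanMul ha hb
    rwa [← spanMul_assoc, hM] at this
  have r_mul : ∀ a ∈ M ⊙ N, ∀ x ∈ M ⊙ N, r (a * x) = a * r x := by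
    intro a ha x hx
    rw [← sub_eq_zero]
    have hm : r (a * x) - a * r x ∈ M :=
      M.sub_mem (r_mem _ (hDD a ha x hx)) (hDM a ha _ (r_mem x hx))
    -- By `adj` the difference annihilates `N`, hence `N ⊙ M`, which contains a right unit for each
    -- element of `M`.
    have h0 : ∀ y ∈ N ⊙ M, (r (a * x) - a * r x) * y = 0 := by
      intro y hy
      refine spanMul_induction (p := fun y => (r (a * x) - a * r x) * y = 0) hy ?_ ?_
      · intro n hn m _
        rw [← mul_assoc, sub_mul, adj _ (hDD a ha x hx) n hn, mul_assoc, mul_assoc, adj x hx n hn,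
          sub_self, zero_mul]
      · intro y z hy hz
        rw [mul_add, hy, hz, add_zero]
    obtain ⟨e, he, h⟩ := hD'.exists_right_unit (S := M) (x := r (a * x) - a * r x)
      (by rwa [← spanMul_assoc, hM])
    rw [← h, h0 e he]
  have ht : ∀ y ∈ N ⊙ M, ∃ a ∈ M ⊙ N, ∀ x ∈ M ⊙ N, r (x * a) = r x * y := by
    intro y hy
    refine spanMul_induction
      (p := fun y => ∃ a ∈ M ⊙ N, ∀ x ∈ M ⊙ N, r (x * a) = r x * y) hy ?_ ?_
    · intro n hn m hm
      obtain ⟨b, hb, rfl⟩ := r_surj m hm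
      refine ⟨l n * b, hDD _ (l_mem n hn) b hb, fun x hx => ?_⟩
      rw [← mul_assoc, r_mul _ (hDD x hx _ (l_mem n hn)) b hb, ← mul_assoc, adj x hx n hn]
    · rintro y z ⟨a, ha, hy⟩ ⟨b, hb, hz⟩
      refine ⟨a + b, (M ⊙ N).add_mem ha hb, fun x hx => ?_⟩
      rw [mul_add, r_add _ (hDD x hx a ha) _ (hDD x hx b hb), hy x hx, hz x hx, mul_add]
  choose! t ht ht' using ht
  refine ⟨t, r_mem, r_surj, r_inj, r_add, r_smul, r_mul, ht, fun a ha => ?_,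
    fun x hx y hy => ht' y hy x hx⟩
  obtain ⟨e, he, hea, -⟩ := hD.single ha
  obtain ⟨n, hn, rfl⟩ := l_surj e he
  have hy : n * r a ∈ N ⊙ M := mul_mem_spanMul hn (r_mem a ha)
  -- With `u n = e` and `e a = a`, the element `y = n (a u)` satisfies `u y u⁻¹ = e a = a`.
  refine ⟨n * r a, hy, ?_⟩
  obtain ⟨f, hf, h1, -, h2, -⟩ := hD.pair ha (ht _ hy)
  refine h2.symm.trans (Eq.trans ?_ h1)
  refine r_inj _ (hDD f hf _ (ht _ hy)) _ (hDD f hf a ha) ?_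
  rw [ht' _ hy f hf, ← mul_assoc, adj f hf n hn, ← r_mul _ (hDD f hf _ he) a ha, mul_assoc,
    hea]

end Trivialization

namespace FMat

/-! ### Finite matrices by rows and by columns -/

section Rows

variable {X k B : Type*} [CommRing k] [NonUnitalRing B] [Module k B]

/-- The matrix with given rows. -/
def ofRows (S : Submodule k B) : (X →₀ X →₀ S) →ₗ[k] FMat X B :=
  (Finsupp.mapRange.linearMap S.subtype : (X × X →₀ S) →ₗ[k] (X × X →₀ B)) ∘ₗ
    (Finsupp.curryLinearEquiv k).symm.toLinearMap

/-- The matrix with given columns. -/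
def ofCols (S : Submodule k B) : (X →₀ X →₀ S) →ₗ[k] FMat X B :=
  (Finsupp.mapRange.linearMap S.subtype : (X × X →₀ S) →ₗ[k] (X × X →₀ B)) ∘ₗ
    (Finsupp.domLCongr (Equiv.prodComm X X)).toLinearMap ∘ₗ
      (Finsupp.curryLinearEquiv k).symm.toLinearMap

theorem entry_ofRows (S : Submodule k B) (f : X →₀ X →₀ S) (x y : X) :
    (ofRows S f).entry x y = f x y := rfl

theorem entry_ofCols (S : Submodule k B) (f : X →₀ X →₀ S) (x y : X) :
    (ofCols S f).entry x y = f y x := rfl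

theorem ofRows_injective (S : Submodule k B) : Function.Injective (ofRows (X := X) S) := by
  intro f g h
  ext x y
  rw [← entry_ofRows, ← entry_ofRows, h]

theorem ofCols_injective (S : Submodule k B) : Function.Injective (ofCols (X := X) S) := by
  intro f g h
  ext x y
  rw [← entry_ofCols, ← entry_ofCols, h]

theorem ofRows_mem (S : Submodule k B) (f : X →₀ X →₀ S) : ofRows S f ∈ component X S :=
  fun x y => (f x y).2

theorem ofCols_mem (S : Submodule k B) (f : X →₀ X →₀ S) : ofCols S f ∈ component X S :=
  fun x y => (f y x).2

theorem exists_ofRows {S : Submodule k B} {a : FMat X B} (ha : a ∈ component X S) :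
    ∃ f, ofRows S f = a := by
  classical
  let g : X × X →₀ S := Finsupp.onFinset (show X × X →₀ B from a).support
    (fun p => ⟨a.entry p.1 p.2, ha p.1 p.2⟩) (fun p hp => by
      rw [Finsupp.mem_support_iff]
      exact fun h => hp (Subtype.ext h))
  exact ⟨g.curry, FMat.ext fun x y => rfl⟩

theorem exists_ofCols {S : Submodule k B} {a : FMat X B} (ha : a ∈ component X S) :
    ∃ f, ofCols S f = a := by
  obtain ⟨f, rfl⟩ := exists_ofRows ha
  exact ⟨(Finsupp.domLCongr (R := k) (Equiv.prodComm X X) f.uncurry).curry,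
    FMat.ext fun x y => rfl⟩

/-- The matrix with a single non-zero entry. -/
def single (x y : X) (b : B) : FMat X B := Finsupp.single (x, y) b

open Classical in
theorem entry_single (x y x' y' : X) (b : B) :
    (single x y b).entry x' y' = if x = x' ∧ y = y' then b else 0 := by
  change (Finsupp.single (x, y) b : X × X →₀ B) (x', y') = _
  simp [Finsupp.single_apply]

theorem single_mem {S : Submodule k B} (x y : X) {b : B} (hb : b ∈ S) :
    single x y b ∈ component X S := by
  classical
  intro x' y'
  rw [entry_single]
  split_ifs
  exacts [hb, S.zero_mem]

theorem single_mul_single (x y z : X) (a b : B) :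
    single x y a * single y z b = single x z (a * b) := by
  classical
  ext x' z'
  -- If `a = 0` then `y` is not among the non-zero columns, so it is added to the summation range.
  rw [entry_mul_of_subset _ _ _ _ (S := insert y (single x y a).cols) (Finset.subset_insert _ _),
    Finset.sum_eq_single y]
  · simp only [entry_single]
    by_cases h1 : x = x' <;> by_cases h2 : z = z' <;> simp [h1, h2]
  · intro y' _ hy
    simp [entry_single, Ne.symm hy]
  · simp

theorem eq_sum_single (a : FMat X B) :
    a = ∑ p ∈ (show X × X →₀ B from a).support, single p.1 p.2 (a.entry p.1 p.2) :=
  (Finsupp.sum_single (show X × X →₀ B from a)).symm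

/-- A unit `e` for all the entries is placed on the diagonal at the finitely many indices of
non-zero rows or columns. -/
theorem hasCommonUnits_component {D : Submodule k B} (h : HasCommonUnits D) :
    HasCommonUnits (component X D) := by
  classical
  intro s hs
  let P : Finset (X × X) := s.biUnion fun a => (show X × X →₀ B from a).support
  obtain ⟨e, he, hu⟩ := h ((s ×ˢ P).image fun q => q.1.entry q.2.1 q.2.2) (by
    intro b hb
    obtain ⟨q, hq, rfl⟩ := Finset.mem_image.1 hb
    exact hs q.1 (Finset.mem_product.1 hq).1 _ _)
  have hu' : ∀ a ∈ s, ∀ x y, e * a.entry x y = a.entry x y ∧ a.entry x y * e = a.entry x y := by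
    intro a ha x y
    by_cases h0 : a.entry x y = 0
    · simp [h0]
    · refine hu _ (Finset.mem_image.2 ⟨(a, (x, y)), Finset.mem_product.2 ⟨ha, ?_⟩, rfl⟩)
      exact Finset.mem_biUnion.2 ⟨a, ha, Finsupp.mem_support_iff.2 h0⟩
  let Q : Finset X := P.image Prod.fst ∪ P.image Prod.snd
  have hQ : ∀ a ∈ s, ∀ x y, a.entry x y ≠ 0 → x ∈ Q ∧ y ∈ Q := by
    intro a ha x y h0
    have : (x, y) ∈ P := Finset.mem_biUnion.2 ⟨a, ha, Finsupp.mem_support_iff.2 h0⟩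
    exact ⟨Finset.mem_union_left _ (Finset.mem_image.2 ⟨_, this, rfl⟩),
      Finset.mem_union_right _ (Finset.mem_image.2 ⟨_, this, rfl⟩)⟩
  let d : FMat X B := ∑ x ∈ Q, single x x e
  have entry_sum : ∀ x y, d.entry x y = ∑ z ∈ Q, (single z z e).entry x y := fun x y =>
    map_sum ((Finsupp.applyAddHom (x, y) : (X × X →₀ B) →+ B)) _ _
  have hd : ∀ x y, d.entry x y = if x = y ∧ x ∈ Q then e else 0 := by
    intro x y
    rw [entry_sum]
    by_cases hxy : x = y
    · subst hxy
      simp [entry_single, Finset.sum_ite_eq']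
    · rw [if_neg (fun h => hxy h.1)]
      refine Finset.sum_eq_zero fun z _ => ?_
      rw [entry_single, if_neg]
      rintro ⟨rfl, rfl⟩
      exact hxy rfl
  refine ⟨d, Submodule.sum_mem _ fun x _ => single_mem _ _ he, fun a ha => ⟨?_, ?_⟩⟩
  · ext x y
    rw [entry_mul_of_subset _ _ _ _ (S := insert x d.cols) (Finset.subset_insert _ _),
      Finset.sum_eq_single x]
    · rw [hd]
      by_cases h0 : a.entry x y = 0
      · simp [h0]
      · simp [(hQ a ha x y h0).1, (hu' a ha x y).1]
    · intro z _ hz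
      simp [hd, Ne.symm hz]
    · simp
  · ext x y
    rw [entry_mul_of_subset _ _ _ _ (S := insert y a.cols) (Finset.subset_insert _ _),
      Finset.sum_eq_single y]
    · rw [hd]
      by_cases h0 : a.entry x y = 0
      · simp [h0]
      · simp [(hQ a ha x y h0).2, (hu' a ha x y).2]
    · intro z _ hz
      simp [hd, hz]
    · simp

variable [IsScalarTower k B B] [SMulCommClass k B B]

/-- This is the link between matrices and pairings: adjoint maps on rows and columns become maps
`r`, `l` of matrices with `r x * n = x * l n`. -/
theorem entry_ofRows_mul_ofCols (S S' : Submodule k B) (f : X →₀ X →₀ S) (g : X →₀ X →₀ S')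
    (x z : X) : (ofRows S f * ofCols S' g).entry x z =
      powPairing X (mulPairing S S') (f x) (g z) := by
  classical
  rw [entry_mul_of_subset _ _ _ _ (S := (ofRows S f).cols ∪ (f x).support)
    Finset.subset_union_left, powPairing_apply,
    Finsupp.sum_of_support_subset (s := (ofRows S f).cols ∪ (f x).support)]
  · rfl
  · exact Finset.subset_union_right
  · simp

theorem component_spanMul [Nonempty X] (S T : Submodule k B) :
    component X (S ⊙ T) = component X S ⊙ component X T := by
  classical
  apply le_antisymm
  · intro a ha
    rw [eq_sum_single a]
    refine Submodule.sum_mem _ fun p _ => ?_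
    refine spanMul_induction (p := fun b => single p.1 p.2 b ∈ component X S ⊙ component X T)
      (ha p.1 p.2) ?_ ?_
    · intro s hs t ht
      rw [← single_mul_single p.1 p.1 p.2]
      exact mul_mem_spanMul (single_mem _ _ hs) (single_mem _ _ ht)
    · intro b c hb hc
      have : single p.1 p.2 (b + c) = single p.1 p.2 b + single p.1 p.2 c :=
        Finsupp.single_add _ _ _
      rw [this]
      exact Submodule.add_mem _ hb hc
  · rw [spanMul_le]
    intro a ha b hb x z
    rw [entry_mul]
    exact Submodule.sum_mem _ fun y _ => mul_mem_spanMul (ha x y) (hb y z)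

end Rows

section Stable

variable {k B : Type*} [CommRing k] [NonUnitalRing B] [Module k B]
  [IsScalarTower k B B] [SMulCommClass k B B]

theorem exists_isTrivialization_component {M N : Submodule k B} {E E' : Set B}
    (hE : IsOrthogonalUnitSet (M ⊙ N) E) (hE' : IsOrthogonalUnitSet (N ⊙ M) E')
    (hM : M ⊙ N ⊙ M = M) (hN : N ⊙ M ⊙ N = N) :
    ∃ r t, IsTrivialization (component (B × ℕ) M) (component (B × ℕ) N) r t := by
  obtain ⟨R, L, hRL⟩ := pairingEquiv_of_orthogonalUnitSets hE hE' hM hN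
  let X := B × ℕ
  -- `r` applies `R` to every row and `l` applies `L` to every column. The value `0` elsewhere is
  -- irrelevant, since only matrices over `M ⊙ N` and over `N`, respectively, are considered.
  let r : FMat X B → FMat X B := Function.extend (ofRows (M ⊙ N))
    (fun f => ofRows M (Finsupp.mapRange.linearMap R.toLinearMap f)) 0
  let l : FMat X B → FMat X B := Function.extend (ofCols N)
    (fun f => ofCols (M ⊙ N) (Finsupp.mapRange.linearMap L.toLinearMap f)) 0
  have hr : ∀ f, r (ofRows (M ⊙ N) f) = ofRows M (Finsupp.mapRange.linearMap R.toLinearMap f) :=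
    fun f => (ofRows_injective _).extend_apply _ _ f
  have hl : ∀ f, l (ofCols N f) = ofCols (M ⊙ N) (Finsupp.mapRange.linearMap L.toLinearMap f) :=
    fun f => (ofCols_injective _).extend_apply _ _ f
  have hD := hasCommonUnits_component (X := X) hE.hasCommonUnits
  have hD' := hasCommonUnits_component (X := X) hE'.hasCommonUnits
  rw [component_spanMul] at hD hD'
  refine ⟨r, exists_isTrivialization hD hD' ?_ (l := l) ?_ ?_ ?_ ?_ ?_ ?_ ?_ ?_⟩
  · rw [← component_spanMul, ← component_spanMul, hM]
  all_goals rw [← component_spanMul]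
  · intro x hx
    obtain ⟨f, rfl⟩ := exists_ofRows hx
    rw [hr]
    exact ofRows_mem _ _
  · intro m hm
    obtain ⟨f, rfl⟩ := exists_ofRows hm
    refine ⟨_, ofRows_mem _ (Finsupp.mapRange.linearMap R.symm.toLinearMap f), ?_⟩
    rw [hr]
    congr 1
    ext
    simp
  · intro x hx y hy h
    obtain ⟨f, rfl⟩ := exists_ofRows hx
    obtain ⟨g, rfl⟩ := exists_ofRows hy
    rw [hr, hr] at h
    congr 1
    have := ofRows_injective _ h
    ext1 i
    exact R.injective (DFunLike.congr_fun this i)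
  · intro x hx y hy
    obtain ⟨f, rfl⟩ := exists_ofRows hx
    obtain ⟨g, rfl⟩ := exists_ofRows hy
    rw [← map_add, hr, hr, hr, map_add, map_add]
  · intro c x hx
    obtain ⟨f, rfl⟩ := exists_ofRows hx
    rw [← map_smul, hr, hr, map_smul, map_smul]
  · intro n hn
    obtain ⟨f, rfl⟩ := exists_ofCols hn
    rw [hl]
    exact ofCols_mem _ _
  · intro m hm
    obtain ⟨f, rfl⟩ := exists_ofCols hm
    refine ⟨_, ofCols_mem _ (Finsupp.mapRange.linearMap L.symm.toLinearMap f), ?_⟩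
    rw [hl]
    congr 1
    ext
    simp
  · intro x hx n hn
    obtain ⟨f, rfl⟩ := exists_ofRows hx
    obtain ⟨g, rfl⟩ := exists_ofCols hn
    rw [hr, hl]
    ext x z
    rw [entry_ofRows_mul_ofCols, entry_ofRows_mul_ofCols]
    exact hRL _ _

end Stable

section Graded

variable {X k B G : Type*} [CommRing k] [NonUnitalRing B] [Module k B] [DecidableEq G]

theorem isInternal_component {𝓑 : G → Submodule k B} (h : DirectSum.IsInternal 𝓑) :
    DirectSum.IsInternal fun g => component X (𝓑 g) := by
  refine DirectSum.isInternal_submodule_of_iSupIndep_of_iSup_eq_top ?_ ?_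
  · intro g
    rw [Submodule.disjoint_def]
    intro a ha ha'
    ext x y
    let π : FMat X B →ₗ[k] B := (Finsupp.lapply (x, y) : (X × X →₀ B) →ₗ[k] B)
    refine Submodule.disjoint_def.1 (h.submodule_iSupIndep g) _ (ha x y) ?_
    have : (⨆ j, ⨆ (_ : j ≠ g), component X (𝓑 j)) ≤ (⨆ j, ⨆ (_ : j ≠ g), 𝓑 j).comap π :=
      iSup₂_le fun j hj b hb => (le_iSup₂ (f := fun j (_ : j ≠ g) => 𝓑 j) j hj) (hb x y)
    exact this ha'
  · rw [eq_top_iff]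
    intro a _
    rw [eq_sum_single a]
    refine Submodule.sum_mem _ fun p _ => ?_
    let s : B →ₗ[k] FMat X B := (Finsupp.lsingle p : B →ₗ[k] (X × X →₀ B))
    have : (⨆ g, 𝓑 g) ≤ (⨆ g, component X (𝓑 g)).comap s :=
      iSup_le fun g b hb => (le_iSup (fun g => component X (𝓑 g)) g) (single_mem p.1 p.2 hb)
    rw [h.submodule_iSup_eq_top] at this
    exact this trivial

end Graded

end FMat

end

noncomputable section

/-! ### Calculus with the formal multipliers `u_g` -/

section Graded

variable {k G C : Type*} [CommRing k] [Group G] [NonUnitalRing C] [Module k C]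
  [IsScalarTower k C C] [SMulCommClass k C C]

/-- The ideal `C_g · C_{g⁻¹}` of `C_1`. -/
def gradedDom (𝓒 : G → Submodule k C) (g : G) : Submodule k C := 𝓒 g ⊙ 𝓒 g⁻¹

/-- A graded algebra whose homogeneous components `C_g` are trivialized by maps `r g` (right
multiplication by `u_g`) and `t g` (conjugation with `u_g`). -/
structure IsTrivialized (𝓒 : G → Submodule k C) (r t : G → C → C) : Prop where
  mul_mem : ∀ {g h : G} {a b : C}, a ∈ 𝓒 g → b ∈ 𝓒 h → a * b ∈ 𝓒 (g * h)
  units : ∀ g, HasCommonUnits (gradedDom 𝓒 g)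
  triv : ∀ g, IsTrivialization (𝓒 g) (𝓒 g⁻¹) (r g) (t g)
  mem_dom_one : ∀ {x}, x ∈ 𝓒 1 → x ∈ gradedDom 𝓒 1
  r_one : ∀ x ∈ 𝓒 1, r 1 x = x

namespace IsTrivialized

variable {𝓒 : G → Submodule k C} {r t : G → C → C} (H : IsTrivialized 𝓒 r t)

include H

theorem dom_le {g : G} {x : C} (hx : x ∈ gradedDom 𝓒 g) : x ∈ 𝓒 1 := by
  have : gradedDom 𝓒 g ≤ 𝓒 1 := spanMul_le.2 fun a ha b hb => by simpa using H.mul_mem ha hb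
  exact this hx

theorem conj_mem_dom {g h : G} {a x b : C} (ha : a ∈ 𝓒 g) (hx : x ∈ gradedDom 𝓒 h)
    (hb : b ∈ 𝓒 g⁻¹) : a * x * b ∈ gradedDom 𝓒 (g * h) := by
  refine spanMul_induction (p := fun x => a * x * b ∈ gradedDom 𝓒 (g * h)) hx ?_ ?_
  · intro m hm n hn
    rw [← mul_assoc, mul_assoc]
    refine mul_mem_spanMul (H.mul_mem ha hm) ?_
    rw [mul_inv_rev]
    exact H.mul_mem hn hb
  · intro x y hx hy
    rw [mul_add, add_mul]
    exact Submodule.add_mem _ hx hy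

theorem mul_mem_dom_left {g : G} {a x : C} (ha : a ∈ 𝓒 1) (hx : x ∈ gradedDom 𝓒 g) :
    a * x ∈ gradedDom 𝓒 g := by
  refine spanMul_induction (p := fun x => a * x ∈ gradedDom 𝓒 g) hx ?_ ?_
  · intro m hm n hn
    rw [← mul_assoc]
    exact mul_mem_spanMul (by simpa using H.mul_mem ha hm) hn
  · intro x y hx hy
    rw [mul_add]
    exact Submodule.add_mem _ hx hy

theorem mul_mem_dom_right {g : G} {a x : C} (ha : a ∈ 𝓒 1) (hx : x ∈ gradedDom 𝓒 g) :
    x * a ∈ gradedDom 𝓒 g := by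
  refine spanMul_induction (p := fun x => x * a ∈ gradedDom 𝓒 g) hx ?_ ?_
  · intro m hm n hn
    rw [mul_assoc]
    exact mul_mem_spanMul hm (by simpa using H.mul_mem hn ha)
  · intro x y hx hy
    rw [add_mul]
    exact Submodule.add_mem _ hx hy

theorem mul_mem_dom {g : G} {a x : C} (ha : a ∈ gradedDom 𝓒 g) (hx : x ∈ gradedDom 𝓒 g) :
    a * x ∈ gradedDom 𝓒 g := H.mul_mem_dom_left (H.dom_le ha) hx

omit H in
theorem mem_dom_inv {g : G} {x : C} : x ∈ gradedDom 𝓒 g⁻¹ ↔ x ∈ 𝓒 g⁻¹ ⊙ 𝓒 g := by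
  rw [gradedDom, inv_inv]

theorem r_mem {g : G} {x : C} (hx : x ∈ gradedDom 𝓒 g) : r g x ∈ 𝓒 g := (H.triv g).r_mem x hx

theorem r_surj {g : G} {c : C} (hc : c ∈ 𝓒 g) : ∃ x ∈ gradedDom 𝓒 g, r g x = c :=
  (H.triv g).r_surj c hc

theorem r_inj {g : G} {x y : C} (hx : x ∈ gradedDom 𝓒 g) (hy : y ∈ gradedDom 𝓒 g)
    (h : r g x = r g y) : x = y := (H.triv g).r_inj x hx y hy h

theorem r_add {g : G} {x y : C} (hx : x ∈ gradedDom 𝓒 g) (hy : y ∈ gradedDom 𝓒 g) :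
    r g (x + y) = r g x + r g y := (H.triv g).r_add x hx y hy

theorem r_smul {g : G} (c : k) {x : C} (hx : x ∈ gradedDom 𝓒 g) : r g (c • x) = c • r g x :=
  (H.triv g).r_smul c x hx

theorem t_mem {g : G} {y : C} (hy : y ∈ gradedDom 𝓒 g⁻¹) : t g y ∈ gradedDom 𝓒 g :=
  (H.triv g).t_mem y (mem_dom_inv.1 hy)

theorem t_surj {g : G} {x : C} (hx : x ∈ gradedDom 𝓒 g) : ∃ y ∈ gradedDom 𝓒 g⁻¹, t g y = x := by
  obtain ⟨y, hy, h⟩ := (H.triv g).t_surj x hx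
  exact ⟨y, mem_dom_inv.2 hy, h⟩

theorem r_mul_t {g : G} {x y : C} (hx : x ∈ gradedDom 𝓒 g) (hy : y ∈ gradedDom 𝓒 g⁻¹) :
    r g (x * t g y) = r g x * y := (H.triv g).r_mul_t x hx y (mem_dom_inv.1 hy)

theorem r_mul {g : G} {a x : C} (ha : a ∈ 𝓒 1) (hx : x ∈ gradedDom 𝓒 g) :
    r g (a * x) = a * r g x := by
  -- A trivialization is linear over `D_g` only; replacing `a` by `a e`, for a unit `e` of `x`,
  -- extends this to `C_1`.
  obtain ⟨e, he, h, -⟩ := (H.units g).single hx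
  have := (H.triv g).r_mul (a * e) (H.mul_mem_dom_left ha he) x hx
  rw [mul_assoc, h, mul_assoc, ← (H.triv g).r_mul e he x hx, h] at this
  exact this

theorem r_t {g : G} {f y : C} (hf : f ∈ gradedDom 𝓒 g) (hy : y ∈ gradedDom 𝓒 g⁻¹)
    (h : f * t g y = t g y) : r g (t g y) = r g f * y := by
  rw [← H.r_mul_t hf hy, h]

/-- This reduces identities for `t` to identities for `r`, because `r_mul_t` eliminates `t` from `r
g (x * t g y)`. -/
theorem eq_of_r_mul {g : G} {a b : C} (ha : a ∈ gradedDom 𝓒 g) (hb : b ∈ gradedDom 𝓒 g)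
    (h : ∀ x ∈ gradedDom 𝓒 g, r g (x * a) = r g (x * b)) : a = b := by
  obtain ⟨e, he, h1, -, h2, -⟩ := (H.units g).pair ha hb
  rw [← h1, ← h2]
  exact H.r_inj (H.mul_mem_dom he ha) (H.mul_mem_dom he hb) (h e he)

theorem t_add {g : G} {x y : C} (hx : x ∈ gradedDom 𝓒 g⁻¹) (hy : y ∈ gradedDom 𝓒 g⁻¹) :
    t g (x + y) = t g x + t g y := by
  have hxy := Submodule.add_mem _ hx hy
  refine H.eq_of_r_mul (H.t_mem hxy) (Submodule.add_mem _ (H.t_mem hx) (H.t_mem hy)) ?_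
  intro e he
  rw [H.r_mul_t he hxy, mul_add, mul_add, H.r_add (H.mul_mem_dom he (H.t_mem hx))
    (H.mul_mem_dom he (H.t_mem hy)), H.r_mul_t he hx, H.r_mul_t he hy]

theorem t_smul {g : G} (c : k) {x : C} (hx : x ∈ gradedDom 𝓒 g⁻¹) : t g (c • x) = c • t g x := by
  have hcx := Submodule.smul_mem _ c hx
  refine H.eq_of_r_mul (H.t_mem hcx) (Submodule.smul_mem _ c (H.t_mem hx)) ?_
  intro e he
  rw [H.r_mul_t he hcx, mul_smul_comm, mul_smul_comm, H.r_smul c (H.mul_mem_dom he (H.t_mem hx)),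
    H.r_mul_t he hx]

theorem t_mul {g : G} {x y : C} (hx : x ∈ gradedDom 𝓒 g⁻¹) (hy : y ∈ gradedDom 𝓒 g⁻¹) :
    t g (x * y) = t g x * t g y := by
  have hxy := H.mul_mem_dom hx hy
  refine H.eq_of_r_mul (H.t_mem hxy) (H.mul_mem_dom (H.t_mem hx) (H.t_mem hy)) ?_
  intro e he
  rw [H.r_mul_t he hxy, ← mul_assoc, ← mul_assoc, H.r_mul_t (H.mul_mem_dom he (H.t_mem hx)) hy,
    H.r_mul_t he hx]

/-- The values of `r g` fill `C_g`, and `C_{g⁻¹} C_g = D_{g⁻¹}` contains a left unit of `x`. -/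
theorem r_mul_eq_zero {g : G} {x : C} (hx : x ∈ gradedDom 𝓒 g⁻¹)
    (h : ∀ e ∈ gradedDom 𝓒 g, r g e * x = 0) : x = 0 := by
  obtain ⟨e, he, h1, -⟩ := (H.units g⁻¹).single hx
  rw [← h1]
  refine spanMul_induction (p := fun e => e * x = 0) he ?_ ?_
  · intro m hm n hn
    rw [inv_inv] at hn
    obtain ⟨y, hy, rfl⟩ := H.r_surj hn
    rw [mul_assoc, h y hy, mul_zero]
  · intro x y hx hy
    rw [add_mul, hx, hy, add_zero]

theorem t_inj {g : G} {x y : C} (hx : x ∈ gradedDom 𝓒 g⁻¹) (hy : y ∈ gradedDom 𝓒 g⁻¹)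
    (h : t g x = t g y) : x = y := by
  rw [← sub_eq_zero]
  refine H.r_mul_eq_zero (Submodule.sub_mem _ hx hy) fun e he => ?_
  rw [mul_sub, ← H.r_mul_t he hx, ← H.r_mul_t he hy, h, sub_self]

theorem t_one {x : C} (hx : x ∈ 𝓒 1) : t 1 x = x := by
  have hx' : x ∈ gradedDom 𝓒 (1 : G)⁻¹ := by
    rw [inv_one]
    exact H.mem_dom_one hx
  refine H.eq_of_r_mul (H.t_mem hx') (H.mem_dom_one hx) fun e he => ?_
  rw [H.r_mul_t he hx', H.r_one e (H.dom_le he), H.r_one]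
  simpa using H.mul_mem (H.dom_le he) hx

/-- A unit of `θ_g(y)` is a sum of products `m n` with `m = θ_g(z) u_g` and `n ∈ C_{g⁻¹}`. Here
`θ_g(y) m n = u_g y z n`, which lies in `C_g D_h C_{g⁻¹} ⊆ D_{gh}`; a local unit `f` makes sense of
`u_g` as `f u_g`. -/
theorem t_mem_dom {g h : G} {y : C} (hy : y ∈ gradedDom 𝓒 g⁻¹) (hy' : y ∈ gradedDom 𝓒 h) :
    t g y ∈ gradedDom 𝓒 (g * h) := by
  obtain ⟨f, hf, h1, h2⟩ := (H.units g).single (H.t_mem hy)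
  rw [← h2]
  refine spanMul_induction (p := fun e => t g y * e ∈ gradedDom 𝓒 (g * h)) hf ?_ ?_
  · intro m hm n hn
    obtain ⟨x, hx, rfl⟩ := H.r_surj hm
    obtain ⟨z, hz, rfl⟩ := H.t_surj hx
    rw [← mul_assoc, ← H.r_mul (H.dom_le (H.t_mem hy)) hx, ← h1, mul_assoc, ← H.t_mul hy hz,
      H.r_mul_t hf (H.mul_mem_dom hy hz)]
    exact H.conj_mem_dom (H.r_mem hf) (H.mul_mem_dom_right (H.dom_le hz) hy') hn
  · intro x y hx hy
    rw [mul_add]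
    exact Submodule.add_mem _ hx hy

/-- Likewise, a unit of `y` is a sum of products `m (x u_g)` with `m ∈ C_{g⁻¹}`, and `m x u_g y = m
x θ_g(y) u_g` lies in `C_{g⁻¹} D_{gh} C_g ⊆ D_h`. -/
theorem mem_dom_of_t_mem {g h : G} {y : C} (hy : y ∈ gradedDom 𝓒 g⁻¹)
    (hy' : t g y ∈ gradedDom 𝓒 (g * h)) : y ∈ gradedDom 𝓒 h := by
  obtain ⟨f, hf, -, h1⟩ := (H.units g).single (H.t_mem hy)
  obtain ⟨e, he, h2, -⟩ := (H.units g⁻¹).single hy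
  rw [← h2]
  refine spanMul_induction (p := fun e => e * y ∈ gradedDom 𝓒 h) he ?_ ?_
  · intro m hm n hn
    rw [inv_inv] at hn
    obtain ⟨x, hx, rfl⟩ := H.r_surj hn
    rw [mul_assoc, ← H.r_mul_t hx hy, ← h1, ← mul_assoc,
      H.r_mul (H.dom_le (H.mul_mem_dom hx (H.t_mem hy))) hf, ← mul_assoc]
    have := H.conj_mem_dom hm (H.mul_mem_dom_left (H.dom_le hx) hy') (b := r g f)
      (by rw [inv_inv]; exact H.r_mem hf)
    rwa [inv_mul_cancel_left] at this
  · intro x y hx hy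
    rw [add_mul]
    exact Submodule.add_mem _ hx hy

theorem t_mem_dom_inv {g h : G} {b : C} (hb : b ∈ gradedDom 𝓒 (g * h)⁻¹)
    (hb' : b ∈ gradedDom 𝓒 h⁻¹) : t h b ∈ gradedDom 𝓒 g⁻¹ := by
  have := H.t_mem_dom hb' (h := h⁻¹ * g⁻¹) (by rwa [← mul_inv_rev])
  rwa [mul_inv_cancel_left] at this

/-! ### Right multiplication by `u_h` and the twist `w_{g,h}` -/

/-- `c * r h e` does not depend on the choice of a unit `e` with `c * e = c`. -/
theorem mul_r_eq {h : G} {c e e' : C} (he : e ∈ gradedDom 𝓒 h) (he' : e' ∈ gradedDom 𝓒 h)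
    (hc : c * e = c) (hc' : c * e' = c) : c * r h e = c * r h e' := by
  obtain ⟨f, hf, -, h1, -, h2⟩ := (H.units h).pair he he'
  rw [← h1, ← h2, H.r_mul (H.dom_le he) hf, H.r_mul (H.dom_le he') hf, ← mul_assoc, ← mul_assoc,
    hc, hc']

omit H in
/-- `c' = c u_h`, for an element `c` with a right unit in `D_h`. -/
def IsRightMul (𝓒 : G → Submodule k C) (r : G → C → C) (h : G) (c c' : C) : Prop :=
  ∃ e ∈ gradedDom 𝓒 h, c * e = c ∧ c' = c * r h e

theorem rightMul_eq {h : G} {c c' e : C} (hc : IsRightMul 𝓒 r h c c') (he : e ∈ gradedDom 𝓒 h)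
    (hce : c * e = c) : c' = c * r h e := by
  obtain ⟨f, hf, h1, rfl⟩ := hc
  exact H.mul_r_eq hf he h1 hce

theorem rightMul_add {h : G} {c c' d d' : C} (hc : IsRightMul 𝓒 r h c c')
    (hd : IsRightMul 𝓒 r h d d') : IsRightMul 𝓒 r h (c + d) (c' + d') := by
  obtain ⟨e, he, h1, h1'⟩ := id hc
  obtain ⟨f, hf, h2, h2'⟩ := id hd
  obtain ⟨q, hq, -, h3, -, h4⟩ := (H.units h).pair he hf
  have a1 : c * q = c := by rw [← h1, mul_assoc, h3]
  have a2 : d * q = d := by rw [← h2, mul_assoc, h4]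
  exact ⟨q, hq, by rw [add_mul, a1, a2], by
    rw [H.rightMul_eq hc hq a1, H.rightMul_eq hd hq a2, add_mul]⟩

omit H in
theorem rightMul_smul {h : G} {c c' : C} (a : k) (hc : IsRightMul 𝓒 r h c c') :
    IsRightMul 𝓒 r h (a • c) (a • c') := by
  obtain ⟨e, he, h1, rfl⟩ := hc
  exact ⟨e, he, by rw [smul_mul_assoc, h1], by rw [smul_mul_assoc]⟩

omit H in
theorem rightMul_mul {h : G} {c c' : C} (a : C) (hc : IsRightMul 𝓒 r h c c') :
    IsRightMul 𝓒 r h (a * c) (a * c') := by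
  obtain ⟨e, he, h1, rfl⟩ := hc
  exact ⟨e, he, by rw [mul_assoc, h1], by rw [mul_assoc]⟩

/-- Every `m ∈ C_h` is `θ_h(y) u_h = u_h y`, so `c u_h = 0` gives `c C_h = 0`, and `c` has a right
unit in `C_h C_{h⁻¹}`. -/
theorem rightMul_inj {h : G} {c : C} (hc : IsRightMul 𝓒 r h c 0) : c = 0 := by
  obtain ⟨e, he, h1, h2⟩ := hc
  have key : ∀ m ∈ 𝓒 h, c * m = 0 := by
    intro m hm
    obtain ⟨x, hx, rfl⟩ := H.r_surj hm
    obtain ⟨y, hy, rfl⟩ := H.t_surj hx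
    rw [← h1, mul_assoc, ← H.r_mul (H.dom_le he) (H.t_mem hy), H.r_mul_t he hy, ← mul_assoc, ← h2,
      zero_mul]
  rw [← h1]
  refine spanMul_induction (p := fun e => c * e = 0) he ?_ ?_
  · intro m hm n hn
    rw [← mul_assoc, key m hm, zero_mul]
  · intro x y hx hy
    rw [mul_add, hx, hy, add_zero]

/-- Write `x = θ_g(y)`; then `y ∈ D_h`, and `x u_g = u_g y` inherits the right units of `y`. Thus `x
u_g u_h` is meaningful. -/
theorem exists_right_unit_r {g h : G} {x : C} (hx : x ∈ gradedDom 𝓒 g)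
    (hx' : x ∈ gradedDom 𝓒 (g * h)) : ∃ e ∈ gradedDom 𝓒 h, r g x * e = r g x := by
  obtain ⟨y, hy, rfl⟩ := H.t_surj hx
  obtain ⟨e, he, -, h1⟩ := (H.units h).single (H.mem_dom_of_t_mem hy hx')
  obtain ⟨f, hf, h2, -⟩ := (H.units g).single hx
  exact ⟨e, he, by rw [H.r_t hf hy h2, mul_assoc, h1]⟩

omit H in
/-- `z = x w_{g,h}`, i.e. `z u_{gh} = x u_g u_h`, for `x` in `D_g ∩ D_{gh}`. -/
structure IsTwist (𝓒 : G → Submodule k C) (r : G → C → C) (g h : G) (x z : C) : Prop where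
  left_mem : x ∈ gradedDom 𝓒 g
  left_mem' : x ∈ gradedDom 𝓒 (g * h)
  right_mem : z ∈ gradedDom 𝓒 g
  right_mem' : z ∈ gradedDom 𝓒 (g * h)
  rightMul : IsRightMul 𝓒 r h (r g x) (r (g * h) z)

theorem twist_add {g h : G} {x z x' z' : C} (hx : IsTwist 𝓒 r g h x z)
    (hx' : IsTwist 𝓒 r g h x' z') : IsTwist 𝓒 r g h (x + x') (z + z') where
  left_mem := Submodule.add_mem _ hx.1 hx'.1
  left_mem' := Submodule.add_mem _ hx.2 hx'.2
  right_mem := Submodule.add_mem _ hx.3 hx'.3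
  right_mem' := Submodule.add_mem _ hx.4 hx'.4
  rightMul := by
    rw [H.r_add hx.1 hx'.1, H.r_add hx.4 hx'.4]
    exact H.rightMul_add hx.5 hx'.5

theorem twist_smul {g h : G} {x z : C} (a : k) (hx : IsTwist 𝓒 r g h x z) :
    IsTwist 𝓒 r g h (a • x) (a • z) where
  left_mem := Submodule.smul_mem _ a hx.1
  left_mem' := Submodule.smul_mem _ a hx.2
  right_mem := Submodule.smul_mem _ a hx.3
  right_mem' := Submodule.smul_mem _ a hx.4
  rightMul := by
    rw [H.r_smul a hx.1, H.r_smul a hx.4]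
    exact rightMul_smul a hx.5

theorem twist_mul {g h : G} {a x z : C} (ha : a ∈ 𝓒 1) (hx : IsTwist 𝓒 r g h x z) :
    IsTwist 𝓒 r g h (a * x) (a * z) where
  left_mem := H.mul_mem_dom_left ha hx.1
  left_mem' := H.mul_mem_dom_left ha hx.2
  right_mem := H.mul_mem_dom_left ha hx.3
  right_mem' := H.mul_mem_dom_left ha hx.4
  rightMul := by
    rw [H.r_mul ha hx.1, H.r_mul ha hx.4]
    exact rightMul_mul a hx.5

theorem twist_unique {g h : G} {x z z' : C} (hx : IsTwist 𝓒 r g h x z)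
    (hx' : IsTwist 𝓒 r g h x z') : z = z' := by
  obtain ⟨e, he, h1, h2⟩ := hx.5
  exact H.r_inj hx.4 hx'.4 (h2.trans (H.rightMul_eq hx'.5 he h1).symm)

theorem twist_inj {g h : G} {x x' z : C} (hx : IsTwist 𝓒 r g h x z)
    (hx' : IsTwist 𝓒 r g h x' z) : x = x' := by
  have key := H.twist_add hx (H.twist_smul (-1) hx')
  rw [neg_one_smul, neg_one_smul, add_neg_cancel, ← sub_eq_add_neg] at key
  have hr : ∀ g, r g 0 = 0 := fun g => by
    simpa using H.r_smul (g := g) (0 : k) (Submodule.zero_mem _)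
  have h5 := key.5
  rw [hr] at h5
  rw [← sub_eq_zero]
  exact H.r_inj key.1 (Submodule.zero_mem _) (by rw [hr, H.rightMul_inj h5])

theorem exists_dom_inter_unit {g h : G} {x : C} (hx : x ∈ gradedDom 𝓒 g)
    (hx' : x ∈ gradedDom 𝓒 h) :
    ∃ e ∈ gradedDom 𝓒 g, e ∈ gradedDom 𝓒 h ∧ e * x = x := by
  obtain ⟨e, he, h1, -⟩ := (H.units g).single hx
  obtain ⟨f, hf, h2, -⟩ := (H.units h).single hx'
  exact ⟨e * f, H.mul_mem_dom_right (H.dom_le hf) he, H.mul_mem_dom_left (H.dom_le he) hf, by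
    rw [mul_assoc, h2, h1]⟩

theorem exists_twist {g h : G} {x : C} (hx : x ∈ gradedDom 𝓒 g)
    (hx' : x ∈ gradedDom 𝓒 (g * h)) : ∃ z, IsTwist 𝓒 r g h x z := by
  obtain ⟨e, he, h1⟩ := H.exists_right_unit_r hx hx'
  obtain ⟨z, hz, h2⟩ := H.r_surj (H.mul_mem (H.r_mem hx) (H.r_mem he))
  obtain ⟨d, hd, -, h3⟩ := H.exists_dom_inter_unit hx hx'
  -- A left unit `d` of `x` is also one of `z`; this puts `z` into `D_g`.
  have h4 : d * z = z := by
    refine H.r_inj (H.mul_mem_dom_left (H.dom_le hd) hz) hz ?_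
    rw [H.r_mul (H.dom_le hd) hz, h2, ← mul_assoc, ← H.r_mul (H.dom_le hd) hx, h3]
  exact ⟨z, hx, hx', h4 ▸ H.mul_mem_dom_right (H.dom_le hz) hd, hz, e, he, h1, h2⟩

theorem exists_twist_eq {g h : G} {z : C} (hz : z ∈ gradedDom 𝓒 g)
    (hz' : z ∈ gradedDom 𝓒 (g * h)) : ∃ x, IsTwist 𝓒 r g h x z := by
  obtain ⟨y, hy, h1⟩ : ∃ y ∈ gradedDom 𝓒 h⁻¹, r (g * h) z * y = r (g * h) z :=
    H.exists_right_unit_r hz' (by rwa [mul_inv_cancel_right])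
  -- `c` plays the role of `z u_{gh} u_h⁻¹`: for `y = m (x u_h)` it is `(z u_{gh}) m x`. The clause
  -- on left units is carried along in order to place the final `x` in `D_{gh}`.
  have key : ∃ c ∈ 𝓒 g, IsRightMul 𝓒 r h c (r (g * h) z * y) ∧
      ∀ d, d * r (g * h) z = r (g * h) z → d * c = c := by
    refine spanMul_induction (p := fun y => ∃ c ∈ 𝓒 g, IsRightMul 𝓒 r h c (r (g * h) z * y) ∧
      ∀ d, d * r (g * h) z = r (g * h) z → d * c = c) hy ?_ ?_
    · intro m hm n hn
      rw [inv_inv] at hn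
      obtain ⟨x, hx, rfl⟩ := H.r_surj hn
      obtain ⟨e, he, h2, h3⟩ := (H.units h).single hx
      refine ⟨r (g * h) z * m * x, ?_, ⟨e, he, by rw [mul_assoc, h3], ?_⟩, ?_⟩
      · simpa using H.mul_mem (H.mul_mem (H.r_mem hz') hm) (H.dom_le hx)
      · rw [mul_assoc _ x, ← H.r_mul (H.dom_le hx) he, h3, mul_assoc]
      · intro d hd
        rw [← mul_assoc, ← mul_assoc, hd]
    · rintro y y' ⟨c, hc, h2, h3⟩ ⟨c', hc', h2', h3'⟩
      refine ⟨c + c', Submodule.add_mem _ hc hc', ?_, fun d hd => ?_⟩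
      · rw [mul_add]
        exact H.rightMul_add h2 h2'
      · rw [mul_add, h3 d hd, h3' d hd]
  obtain ⟨c, hc, h2, h3⟩ := key
  rw [h1] at h2
  obtain ⟨x, hx, rfl⟩ := H.r_surj hc
  obtain ⟨d, hd, hd', h4⟩ := H.exists_dom_inter_unit hz hz'
  have h5 : d * x = x := by
    refine H.r_inj (H.mul_mem_dom_left (H.dom_le hd) hx) hx ?_
    rw [H.r_mul (H.dom_le hd) hx]
    refine h3 d ?_
    rw [← H.r_mul (H.dom_le hd) hz', h4]
  exact ⟨x, hx, h5 ▸ H.mul_mem_dom_right (H.dom_le hx) hd', hz, hz', h2⟩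

/-- `(a w) b = a (w b)`, where `w b = (θ_g θ_h θ_{gh}⁻¹ b) w`. -/
theorem twist_mul_comm {g h : G} {a z b z' : C} (ha : IsTwist 𝓒 r g h a z)
    (hb : b ∈ gradedDom 𝓒 (g * h)⁻¹) (hb' : b ∈ gradedDom 𝓒 h⁻¹)
    (hgb : t h b ∈ gradedDom 𝓒 g⁻¹) (hz' : IsTwist 𝓒 r g h (t g (t h b)) z') :
    z * t (g * h) b = a * z' := by
  have hz1 : z ∈ 𝓒 1 := H.dom_le ha.3
  have ha1 : a ∈ 𝓒 1 := H.dom_le ha.1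
  -- Multiplied by `u_{gh}`, both sides become `a u_g u_h b`.
  refine H.r_inj (H.mul_mem_dom_left hz1 (H.t_mem hb)) (H.mul_mem_dom_left ha1 hz'.4) ?_
  rw [H.r_mul_t ha.4 hb, H.r_mul ha1 hz'.4]
  obtain ⟨f, hf, h1, h2, h3, h4⟩ := (H.units g).pair ha.1 (H.t_mem hgb)
  obtain ⟨e, he, h5, h6⟩ := ha.5
  obtain ⟨e', he', h7, h8, h9, h10⟩ := (H.units h).pair he (H.t_mem hb')
  have h11 : r g a * e' = r g a := by rw [← h5, mul_assoc, h8]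
  have h12 : r g (t g (t h b)) = r g f * t h b := H.r_t hf hgb h3
  rw [H.rightMul_eq ha.5 he' h11, H.rightMul_eq hz'.5 he' (by rw [h12, mul_assoc, h10]), h12,
    mul_assoc (r g f), ← H.r_mul (H.dom_le (H.t_mem hb')) he', h10, H.r_t he' hb' h9, ← mul_assoc,
    ← H.r_mul ha1 hf, h2, mul_assoc]

/-- Both sides of the cocycle identity become `u_g a u_h u_f` after multiplication by `u_{ghf}`. In
the computation `q u_g` stands for `u_g`, with `q` a common left unit of `θ_g(a)` and `θ_g(b)`. -/
theorem twist_cocycle {g h f : G} {a b z₁ y z₂ : C} (ha : a ∈ gradedDom 𝓒 g⁻¹)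
    (hb : IsTwist 𝓒 r h f a b) (hgb : b ∈ gradedDom 𝓒 g⁻¹)
    (hz₁ : IsTwist 𝓒 r g (h * f) (t g b) z₁) (hy : IsTwist 𝓒 r g h (t g a) y)
    (hz₂ : IsTwist 𝓒 r (g * h) f y z₂) : z₁ = z₂ := by
  have hm := hz₂.4
  rw [mul_assoc] at hm
  refine H.r_inj hz₁.4 hm ?_
  obtain ⟨q, hq, h1, -, h2, -⟩ := (H.units g).pair (H.t_mem ha) (H.t_mem hgb)
  have ea := H.r_t hq ha h1
  have eb := H.r_t hq hgb h2
  obtain ⟨e₁, he₁, -, h3⟩ := (H.units (h * f)).single hb.4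
  obtain ⟨e₄, he₄, -, h4⟩ := (H.units h).single hb.1
  obtain ⟨e₂, he₂, h5, h6⟩ := hb.5
  have hyr : r (g * h) y = r g q * r h a := by
    rw [H.rightMul_eq hy.5 he₄ (by rw [ea, mul_assoc, h4]), ea, mul_assoc,
      ← H.r_mul (H.dom_le hb.1) he₄, h4]
  rw [H.rightMul_eq hz₁.5 he₁ (by rw [eb, mul_assoc, h3]), eb, mul_assoc,
    ← H.r_mul (H.dom_le hb.4) he₁, h3, h6, ← mul_assoc g h f,
    H.rightMul_eq hz₂.5 he₂ (by rw [hyr, mul_assoc, h5]), hyr, mul_assoc]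

theorem twist_one_left {g : G} {x : C} (hx : x ∈ gradedDom 𝓒 g) : IsTwist 𝓒 r 1 g x x := by
  have hx1 := H.dom_le hx
  obtain ⟨e, he, -, h⟩ := (H.units g).single hx
  refine ⟨H.mem_dom_one hx1, by rwa [one_mul], H.mem_dom_one hx1, by rwa [one_mul], e, he, ?_, ?_⟩
  · rw [H.r_one x hx1, h]
  · rw [H.r_one x hx1, one_mul, ← H.r_mul hx1 he, h]

theorem twist_one_right {g : G} {x : C} (hx : x ∈ gradedDom 𝓒 g) : IsTwist 𝓒 r g 1 x x := by
  have hx' : x ∈ gradedDom 𝓒 (g * 1) := by rwa [mul_one]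
  obtain ⟨e, he, h⟩ := H.exists_right_unit_r hx hx'
  exact ⟨hx, hx', hx, hx', e, he, h, by rw [H.r_one e (H.dom_le he), h, mul_one]⟩

/-- Multiplicativity of `a δ_g ↦ a u_g`: one has `θ_g(a b) w_{g,h} u_{gh} = u_g a b u_h = (θ_g(a)
u_g)(b u_h)`. -/
theorem r_twist {g h : G} {a b z : C} (ha : a ∈ gradedDom 𝓒 g⁻¹) (hb : b ∈ gradedDom 𝓒 h)
    (hz : IsTwist 𝓒 r g h (t g (a * b)) z) : r (g * h) z = r g (t g a) * r h b := by
  have hab := H.mul_mem_dom_right (H.dom_le hb) ha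
  obtain ⟨f, hf, h1, -, h2, -⟩ := (H.units g).pair (H.t_mem ha) (H.t_mem hab)
  obtain ⟨e, he, -, h3⟩ := (H.units h).single hb
  rw [H.rightMul_eq hz.5 he (by rw [H.r_t hf hab h2, mul_assoc, mul_assoc, h3]),
    H.r_t hf hab h2, H.r_t hf ha h1, ← mul_assoc, mul_assoc _ b, ← H.r_mul (H.dom_le hb) he, h3]

end IsTrivialized

end Graded

end

noncomputable section

/-! ### The twisted partial action and the isomorphism -/

section Packaging

/-- A bijective `k`-linear relation is the graph of a linear equivalence. -/
theorem exists_linearEquiv_of_rel {k V W : Type*} [CommRing k] [AddCommGroup V] [Module k V]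
    [AddCommGroup W] [Module k W] {P : V → W → Prop}
    (add : ∀ {v w v' w'}, P v w → P v' w' → P (v + v') (w + w'))
    (smul : ∀ (c : k) {v w}, P v w → P (c • v) (c • w))
    (total : ∀ v, ∃ w, P v w) (surj : ∀ w, ∃ v, P v w)
    (unique : ∀ {v w w'}, P v w → P v w' → w = w') (inj : ∀ {v v' w}, P v w → P v' w → v = v') :
    ∃ f : V ≃ₗ[k] W, ∀ v, P v (f v) := by
  choose f hf using total
  refine ⟨LinearEquiv.ofBijective
    { toFun := f
      map_add' := fun v v' => unique (hf _) (add (hf v) (hf v'))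
      map_smul' := fun c v => unique (hf _) (smul c (hf v)) } ⟨fun v v' h => ?_, fun w => ?_⟩, hf⟩
  · have h : f v = f v' := h
    exact inj (hf v) (h ▸ hf v')
  · obtain ⟨v, hv⟩ := surj w
    exact ⟨v, unique (hf v) hv⟩

/-- A multiplier whose two components are bijective is invertible. -/
def Multiplier.unitOfEquiv {k I : Type*} [CommRing k] [NonUnitalRing I] [Module k I]
    (R L : I ≃ₗ[k] I) (hR : ∀ a b, R (a * b) = a * R b) (hL : ∀ a b, L (a * b) = L a * b)
    (hRL : ∀ a b, R a * b = a * L b) : (Multiplier k I)ˣ where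
  val := ⟨R, L, hR, hL, hRL⟩
  inv := ⟨R.symm, L.symm,
    fun a b => R.injective (by simp [hR]), fun a b => L.injective (by simp [hL]),
    fun a b => by simpa using (hRL (R.symm a) (L.symm b)).symm⟩
  val_inv := Multiplier.ext (LinearMap.ext R.symm_apply_apply) (LinearMap.ext L.apply_symm_apply)
  inv_val := Multiplier.ext (LinearMap.ext R.apply_symm_apply) (LinearMap.ext L.symm_apply_apply)

variable {k G A C : Type*} [CommRing k] [Group G] [NonUnitalRing A] [Module k A]
  [IsScalarTower k A A] [SMulCommClass k A A] [NonUnitalRing C] [Module k C]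
  [IsScalarTower k C C] [SMulCommClass k C C]

namespace IsTrivialized

variable {𝓒 : G → Submodule k C} {r t : G → C → C} (H : IsTrivialized 𝓒 r t) (ι : A →ₙₐ[k] C)

/-- The ideal `D_g` of an algebra `A` that is identified with `C_1` by `ι`. -/
def dom (hι : ∀ a, ι a ∈ 𝓒 1) (g : G) : AlgIdeal k A where
  toSubmodule := (gradedDom 𝓒 g).comap (ι : A →ₗ[k] C)
  mul_mem_left' a x hx := by
    change ι (a * x) ∈ gradedDom 𝓒 g
    rw [map_mul]
    exact H.mul_mem_dom_left (hι a) hx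
  mul_mem_right' a x hx := by
    change ι (x * a) ∈ gradedDom 𝓒 g
    rw [map_mul]
    exact H.mul_mem_dom_right (hι a) hx

variable (hι : ∀ a, ι a ∈ 𝓒 1) (ι_inj : Function.Injective ι) (ι_surj : ∀ c ∈ 𝓒 1, ∃ a, ι a = c)

omit [IsScalarTower k A A] [SMulCommClass k A A] in
theorem mem_dom {g : G} {a : A} : a ∈ H.dom ι hι g ↔ ι a ∈ gradedDom 𝓒 g := Iff.rfl

include ι_inj ι_surj in
-- Local units turn the product of two of these ideals into their intersection: `a = e a` with `e`
-- in the first ideal.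
theorem mem_dom_mul {g h : G} {a : A} :
    a ∈ H.dom ι hι g * H.dom ι hι h ↔ ι a ∈ gradedDom 𝓒 g ∧ ι a ∈ gradedDom 𝓒 h := by
  refine ⟨fun ha => ⟨AlgIdeal.mul_le_left ha, AlgIdeal.mul_le_right ha⟩, fun ha => ?_⟩
  obtain ⟨e, he, h1, -⟩ := (H.units g).single ha.1
  obtain ⟨e, rfl⟩ := ι_surj e (H.dom_le he)
  have : a = e * a := ι_inj (by rw [map_mul, h1])
  rw [this]
  exact AlgIdeal.mul_mem_mul he ha.2

include ι_inj ι_surj in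
theorem exists_θ (g : G) : ∃ θ : NAlgIso k (H.dom ι hι g⁻¹) (H.dom ι hι g),
    ∀ a, ι (θ.toLinearEquiv a) = t g (ι a) := by
  suffices ∃ f : H.dom ι hι g⁻¹ ≃ₗ[k] H.dom ι hι g, ∀ a, ι (f a) = t g (ι a) by
    obtain ⟨f, hf⟩ := this
    refine ⟨⟨f, fun a b => Subtype.ext (ι_inj ?_)⟩, hf⟩
    change ι (f (a * b)) = ι (f a * f b)
    rw [hf]
    simp only [MulMemClass.coe_mul, map_mul, hf]
    exact H.t_mul a.2 b.2
  refine exists_linearEquiv_of_rel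
    (P := fun (a : H.dom ι hι g⁻¹) (b : H.dom ι hι g) => ι b = t g (ι a)) ?_ ?_ ?_ ?_ ?_ ?_
  · intro a b a' b' h h'
    simp only [AddMemClass.coe_add, map_add, h, h']
    exact (H.t_add a.2 a'.2).symm
  · intro c a b h
    simp only [SetLike.val_smul, map_smul, h]
    exact (H.t_smul c a.2).symm
  · intro a
    have h := H.t_mem a.2
    obtain ⟨b, hb⟩ := ι_surj _ (H.dom_le h)
    exact ⟨⟨b, by rw [mem_dom, hb]; exact h⟩, hb⟩
  · intro b
    obtain ⟨y, hy, h⟩ := H.t_surj b.2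
    obtain ⟨a, rfl⟩ := ι_surj _ (H.dom_le hy)
    exact ⟨⟨a, hy⟩, h.symm⟩
  · intro a b b' h h'
    exact Subtype.ext (ι_inj (h.trans h'.symm))
  · intro a a' b h h'
    exact Subtype.ext (ι_inj (H.t_inj a.2 a'.2 (h.symm.trans h')))

/-- `z = w_{g,h} a`, where `w_{g,h} θ_{gh} (b) = θ_g (θ_h (b)) w_{g,h}`. -/
def IsLeftTwist (𝓒 : G → Submodule k C) (r t : G → C → C) (g h : G) (a z : C) : Prop :=
  ∃ b ∈ gradedDom 𝓒 (g * h)⁻¹, b ∈ gradedDom 𝓒 h⁻¹ ∧ t (g * h) b = a ∧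
    IsTwist 𝓒 r g h (t g (t h b)) z

include ι_inj ι_surj in
-- The right component of `w_{g,h}` is the relation `IsTwist`. The left one is forced by `w_{g,h}
-- θ_{gh}(b) = θ_g(θ_h(b)) w_{g,h}`. Both relations are graphs of linear bijections, which provides
-- the inverse multiplier.
theorem exists_w (g h : G) :
    ∃ w : (Multiplier k ↥(H.dom ι hι g * H.dom ι hι (g * h)))ˣ,
      (∀ a : ↥(H.dom ι hι g * H.dom ι hι (g * h)), IsTwist 𝓒 r g h (ι a) (ι (w.val.right a))) ∧
      (∀ a : ↥(H.dom ι hι g * H.dom ι hι (g * h)),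
        IsLeftTwist 𝓒 r t g h (ι a) (ι (w.val.left a))) := by
  have mem (a : ↥(H.dom ι hι g * H.dom ι hι (g * h))) :=
    (H.mem_dom_mul ι hι ι_inj ι_surj).1 a.2
  have lift {z : C} (hz : z ∈ gradedDom 𝓒 g) (hz' : z ∈ gradedDom 𝓒 (g * h)) :
      ∃ a : ↥(H.dom ι hι g * H.dom ι hι (g * h)), ι a = z := by
    obtain ⟨a, rfl⟩ := ι_surj z (H.dom_le hz)
    exact ⟨⟨a, (H.mem_dom_mul ι hι ι_inj ι_surj).2 ⟨hz, hz'⟩⟩, rfl⟩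
  obtain ⟨R, hR⟩ := exists_linearEquiv_of_rel (k := k)
    (P := fun a b : ↥(H.dom ι hι g * H.dom ι hι (g * h)) => IsTwist 𝓒 r g h (ι a) (ι b))
    (fun h h' => by
      simp only [AddMemClass.coe_add, map_add]
      exact H.twist_add h h')
    (fun c _ _ h => by
      simp only [SetLike.val_smul, map_smul]
      exact H.twist_smul c h)
    (fun a => by
      obtain ⟨z, hz⟩ := H.exists_twist (mem a).1 (mem a).2
      obtain ⟨b, rfl⟩ := lift hz.3 hz.4
      exact ⟨b, hz⟩)
    (fun b => by
      obtain ⟨z, hz⟩ := H.exists_twist_eq (mem b).1 (mem b).2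
      obtain ⟨a, rfl⟩ := lift hz.1 hz.2
      exact ⟨a, hz⟩)
    (fun h h' => Subtype.ext (ι_inj (H.twist_unique h h')))
    (fun h h' => Subtype.ext (ι_inj (H.twist_inj h h')))
  obtain ⟨L, hL⟩ := exists_linearEquiv_of_rel (k := k)
    (P := fun a b : ↥(H.dom ι hι g * H.dom ι hι (g * h)) =>
      IsLeftTwist 𝓒 r t g h (ι a) (ι b))
    (by
      rintro a b a' b' ⟨x, hx1, hx2, hx3, hx4⟩ ⟨y, hy1, hy2, hy3, hy4⟩
      refine ⟨x + y, Submodule.add_mem _ hx1 hy1, Submodule.add_mem _ hx2 hy2, ?_, ?_⟩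
      · rw [H.t_add hx1 hy1, hx3, hy3, ← map_add]
        rfl
      · rw [H.t_add hx2 hy2, H.t_add (H.t_mem_dom_inv hx1 hx2) (H.t_mem_dom_inv hy1 hy2)]
        simp only [AddMemClass.coe_add, map_add]
        exact H.twist_add hx4 hy4)
    (by
      rintro c a b ⟨x, hx1, hx2, hx3, hx4⟩
      refine ⟨c • x, Submodule.smul_mem _ c hx1, Submodule.smul_mem _ c hx2, ?_, ?_⟩
      · rw [H.t_smul c hx1, hx3, ← map_smul]
        rfl
      · rw [H.t_smul c hx2, H.t_smul c (H.t_mem_dom_inv hx1 hx2)]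
        simp only [SetLike.val_smul, map_smul]
        exact H.twist_smul c hx4)
    (fun a => by
      obtain ⟨b, hb, hba⟩ := H.t_surj (mem a).2
      have hb' : b ∈ gradedDom 𝓒 h⁻¹ :=
        H.mem_dom_of_t_mem hb (by rw [mul_inv_cancel_right, hba]; exact (mem a).1)
      have hgb := H.t_mem_dom_inv hb hb'
      obtain ⟨z, hz⟩ := H.exists_twist (H.t_mem hgb) (H.t_mem_dom hgb (H.t_mem hb'))
      obtain ⟨z, rfl⟩ := lift hz.3 hz.4
      exact ⟨z, b, hb, hb', hba, hz⟩)
    (fun z => by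
      obtain ⟨x, hx⟩ := H.exists_twist_eq (mem z).1 (mem z).2
      obtain ⟨y, hy, rfl⟩ := H.t_surj hx.1
      obtain ⟨b, hb, rfl⟩ := H.t_surj (H.mem_dom_of_t_mem hy hx.2)
      have hb' : b ∈ gradedDom 𝓒 (g * h)⁻¹ :=
        H.mem_dom_of_t_mem hb (by rwa [mul_inv_rev, mul_inv_cancel_left])
      have hgb := H.t_mem_dom hb' hb
      rw [mul_inv_cancel_right] at hgb
      obtain ⟨a, ha⟩ := lift hgb (H.t_mem hb')
      exact ⟨a, b, hb', hb, ha.symm, hx⟩)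
    (by
      rintro a z z' ⟨x, hx1, hx2, hx3, hx4⟩ ⟨y, hy1, hy2, hy3, hy4⟩
      obtain rfl : x = y := H.t_inj hx1 hy1 (hx3.trans hy3.symm)
      exact Subtype.ext (ι_inj (H.twist_unique hx4 hy4)))
    (by
      rintro a a' z ⟨x, hx1, hx2, hx3, hx4⟩ ⟨y, hy1, hy2, hy3, hy4⟩
      obtain rfl : x = y := H.t_inj hx2 hy2
        (H.t_inj (H.t_mem_dom_inv hx1 hx2) (H.t_mem_dom_inv hy1 hy2) (H.twist_inj hx4 hy4))
      exact Subtype.ext (ι_inj (hx3.symm.trans hy3)))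
  refine ⟨Multiplier.unitOfEquiv R L (fun a b => Subtype.ext (ι_inj ?_))
    (fun a b => Subtype.ext (ι_inj ?_)) (fun a b => Subtype.ext (ι_inj ?_)), hR, hL⟩
  · refine H.twist_unique (hR _) ?_
    simp only [MulMemClass.coe_mul, map_mul]
    exact H.twist_mul (hι a) (hR b)
  · obtain ⟨x, hx1, hx2, hx3, hx4⟩ := hL a
    obtain ⟨y, hy1, hy2, hy3, hy4⟩ := hL b
    obtain ⟨z, hz1, hz2, hz3, hz4⟩ := hL (a * b)
    have e : z = x * y := by
      refine H.t_inj hz1 (H.mul_mem_dom hx1 hy1) ?_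
      rw [hz3, H.t_mul hx1 hy1, hx3, hy3, ← map_mul]
      rfl
    subst e
    refine H.twist_unique hz4 ?_
    have hgx := H.t_mem_dom_inv hx1 hx2
    have hgy := H.t_mem_dom_inv hy1 hy2
    rw [H.t_mul hx2 hy2, H.t_mul hgx hgy]
    simp only [MulMemClass.coe_mul, map_mul]
    rw [← hy3, H.twist_mul_comm hx4 hy1 hy2 hgy hy4]
    exact H.twist_mul (H.dom_le hx4.1) hy4
  · obtain ⟨y, hy1, hy2, hy3, hy4⟩ := hL b
    simp only [MulMemClass.coe_mul, map_mul]
    rw [← hy3]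
    exact H.twist_mul_comm (hR a) hy1 hy2 (H.t_mem_dom_inv hy1 hy2) hy4

include H hι ι_inj ι_surj in
theorem exists_twistedPartialAction : ∃ Θ : TwistedPartialAction k G A,
    (∀ g a, a ∈ Θ.D g ↔ ι a ∈ gradedDom 𝓒 g) ∧
    (∀ g a, ι ((Θ.θ g).toLinearEquiv a) = t g (ι a)) ∧
    (∀ g h (a : ↥(Θ.D g * Θ.D (g * h))), IsTwist 𝓒 r g h (ι a) (ι ((Θ.w g h).val.right a))) := by
  have mm {g h : G} {a : A} := H.mem_dom_mul ι hι ι_inj ι_surj (g := g) (h := h) (a := a)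
  choose θ hθ using H.exists_θ ι hι ι_inj ι_surj
  choose w hR hL using H.exists_w ι hι ι_inj ι_surj
  let P : PartialActionData k G A :=
    { D := H.dom ι hι
      θ := θ
      D_mul_self := fun g => SetLike.ext fun a => by rw [mm, and_self, mem_dom]
      D_mul_comm := fun g h => SetLike.ext fun a => by rw [mm, mm, and_comm]
      mem_D_one := fun a => H.mem_dom_one (hι a)
      θ_one := fun a => ι_inj (by rw [hθ, H.t_one (hι a)])
      map_θ := fun g h => by
        ext x
        constructor
        · rintro ⟨a, ha, rfl⟩
          have ha := mm.1 ha
          refine mm.2 ?_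
          dsimp only
          rw [hθ]
          exact ⟨H.t_mem ha.1, H.t_mem_dom ha.1 ha.2⟩
        · intro hx
          have hx := mm.1 hx
          obtain ⟨y, hy, h1⟩ := H.t_surj hx.1
          obtain ⟨a, rfl⟩ := ι_surj y (H.dom_le hy)
          refine ⟨⟨a, hy⟩, mm.2 ⟨hy, H.mem_dom_of_t_mem hy (h1 ▸ hx.2)⟩, ι_inj ?_⟩
          dsimp only
          rw [hθ, h1] }
  refine ⟨{ P with
    w := w
    conj := ?_
    w_one_left := ?_
    w_one_right := ?_
    cocycle := ?_ }, fun g a => Iff.rfl, hθ, hR⟩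
  · intro g h a ha
    have ha' := mm.1 ha
    have hb : ι a ∈ gradedDom 𝓒 (g * h)⁻¹ := by
      rw [mul_inv_rev]
      exact ha'.2
    have hgb := H.t_mem_dom_inv hb ha'.1
    obtain ⟨c, hc⟩ := ι_surj _ (H.dom_le (H.t_mem hgb))
    have hcm : c ∈ H.dom ι hι g * H.dom ι hι (g * h) := by
      rw [mm, hc]
      exact ⟨H.t_mem hgb, H.t_mem_dom hgb (H.t_mem ha'.1)⟩
    -- With `c = θ_g(θ_h(a))` this says `w_{g,h} θ_{gh}(a) = c w_{g,h}`; applying `w_{g,h}⁻¹` on the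
    -- right gives the axiom.
    have key : (w g h).val.left ⟨(θ (g * h)).toLinearEquiv ⟨a, hb⟩, P.conj_mem₃ ha⟩ =
        (w g h).val.right ⟨c, hcm⟩ := by
      refine Subtype.ext (ι_inj ?_)
      obtain ⟨x, hx1, hx2, hx3, hx4⟩ := hL g h ⟨(θ (g * h)).toLinearEquiv ⟨a, hb⟩, P.conj_mem₃ ha⟩
      rw [hθ] at hx3
      obtain rfl := H.t_inj hx1 hb hx3
      rw [← hc] at hx4
      exact H.twist_unique hx4 (hR g h ⟨c, hcm⟩)
    have inv : ∀ x, (w g h)⁻¹.val.right ((w g h).val.right x) = x := fun x =>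
      congrArg (fun m : Multiplier k _ => m.right x) (w g h).mul_inv
    refine Eq.trans ?_ (congrArg Subtype.val ((congrArg _ key).trans (inv _))).symm
    refine ι_inj ?_
    rw [hθ]
    change t g (ι _) = ι c
    rw [hθ, hc]
  · intro g
    refine Units.ext (Multiplier.ext (LinearMap.ext fun a => Subtype.ext (ι_inj ?_))
      (LinearMap.ext fun a => Subtype.ext (ι_inj ?_)))
    · refine H.twist_unique (hR 1 g a) (H.twist_one_left ?_)
      simpa using (mm.1 a.2).2
    · obtain ⟨x, hx1, hx2, hx3, hx4⟩ := hL 1 g a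
      rw [H.t_one (H.dom_le (H.t_mem hx2))] at hx4
      have e : t (1 * g) x = t g x := by rw [one_mul]
      rw [← e, hx3] at hx4
      refine H.twist_unique hx4 (H.twist_one_left ?_)
      simpa using (mm.1 a.2).2
  · intro g
    refine Units.ext (Multiplier.ext (LinearMap.ext fun a => Subtype.ext (ι_inj ?_))
      (LinearMap.ext fun a => Subtype.ext (ι_inj ?_)))
    · exact H.twist_unique (hR g 1 a) (H.twist_one_right (mm.1 a.2).1)
    · obtain ⟨x, hx1, hx2, hx3, hx4⟩ := hL g 1 a
      rw [H.t_one (H.dom_le hx2)] at hx4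
      have e : t (g * 1) x = t g x := by rw [mul_one]
      rw [← e, hx3] at hx4
      exact H.twist_unique hx4 (H.twist_one_right (mm.1 a.2).1)
  · intro g h f a ha
    have hag : ι a ∈ gradedDom 𝓒 g⁻¹ := AlgIdeal.mul_le_left (AlgIdeal.mul_le_left ha)
    refine ι_inj (H.twist_cocycle (g := g) (h := h) (f := f) hag
      (hR h f ⟨a, P.cocycle_mem₁ ha⟩) ?_ ?_ ?_ (hR _ _ _))
    · exact AlgIdeal.mul_le_left (P.cocycle_mem₂ ha (w h f).val)
    · have := hR g (h * f) ⟨_, P.θ_mem (P.cocycle_mem₂ ha (w h f).val)⟩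
      rw [hθ] at this
      exact this
    · have := hR g h ⟨_, P.θ_mem (AlgIdeal.mul_le_left ha)⟩
      rw [hθ] at this
      exact this

include H hι ι_inj ι_surj in
theorem exists_crossedProduct_iso [DecidableEq G] (internal : DirectSum.IsInternal 𝓒) :
    ∃ (Θ : TwistedPartialAction k G A) (φ : NAlgIso k C Θ.CrossedProduct),
      ∀ g, (𝓒 g).map (φ.toLinearEquiv : C →ₗ[k] Θ.CrossedProduct) =
        LinearMap.range (TwistedPartialAction.CrossedProduct.δ Θ g) := by
  obtain ⟨Θ, hD, hθ, hw⟩ := H.exists_twistedPartialAction ι hι ι_inj ι_surj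
  have hρ (g : G) : ∃ ρ : Θ.D g ≃ₗ[k] 𝓒 g, ∀ a, (ρ a : C) = r g (ι a) := by
    refine exists_linearEquiv_of_rel (P := fun (a : Θ.D g) (c : 𝓒 g) => (c : C) = r g (ι a))
      ?_ ?_ ?_ ?_ ?_ ?_
    · intro a c a' c' h h'
      simp only [AddMemClass.coe_add, map_add, h, h']
      exact (H.r_add ((hD g _).1 a.2) ((hD g _).1 a'.2)).symm
    · intro x a c h
      simp only [SetLike.val_smul, map_smul, h]
      exact (H.r_smul x ((hD g _).1 a.2)).symm
    · intro a
      exact ⟨⟨_, H.r_mem ((hD g _).1 a.2)⟩, rfl⟩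
    · intro c
      obtain ⟨x, hx, h⟩ := H.r_surj c.2
      obtain ⟨a, rfl⟩ := ι_surj x (H.dom_le hx)
      exact ⟨⟨a, (hD g _).2 hx⟩, h.symm⟩
    · intro a c c' h h'
      exact Subtype.ext (h.trans h'.symm)
    · intro a a' c h h'
      exact Subtype.ext (ι_inj (H.r_inj ((hD g _).1 a.2) ((hD g _).1 a'.2) (h.symm.trans h')))
  choose ρ hρ using hρ
  -- `ψ` is `a δ_g ↦ a u_g`, assembled from the bijections `D_g → C_g`; the required isomorphism is
  -- its inverse.
  let ψ : Θ.CrossedProduct ≃ₗ[k] C :=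
    (DFinsupp.mapRange.linearEquiv ρ : (⨁ g, Θ.D g) ≃ₗ[k] ⨁ g, 𝓒 g).trans
      (LinearEquiv.ofBijective (DirectSum.coeLinearMap 𝓒) internal)
  have hψ : ∀ g (a : Θ.D g), ψ (TwistedPartialAction.CrossedProduct.δ Θ g a) = r g (ι a) := by
    intro g a
    rw [← hρ]
    change DirectSum.coeLinearMap 𝓒 (DFinsupp.mapRange.linearMap (fun g => (ρ g).toLinearMap)
      (DFinsupp.single g a)) = _
    rw [DFinsupp.mapRange.linearMap_apply, DFinsupp.mapRange_single]
    exact DirectSum.coeLinearMap_lof 𝓒 g (ρ g a)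
  have hmul : ∀ x y, ψ (x * y) = ψ x * ψ y := by
    have : (TwistedPartialAction.CrossedProduct.mulHom Θ).compr₂ ψ.toLinearMap =
        (LinearMap.mul k C).compl₁₂ ψ.toLinearMap ψ.toLinearMap := by
      refine DirectSum.linearMap_ext k fun g => LinearMap.ext fun a =>
        DirectSum.linearMap_ext k fun h => LinearMap.ext fun b => ?_
      change ψ (TwistedPartialAction.CrossedProduct.δ Θ g a *
        TwistedPartialAction.CrossedProduct.δ Θ h b) =
        ψ (TwistedPartialAction.CrossedProduct.δ Θ g a) *
          ψ (TwistedPartialAction.CrossedProduct.δ Θ h b)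
      rw [TwistedPartialAction.CrossedProduct.δ_mul_δ, hψ, hψ, hψ]
      -- Writing the first coefficient as `θ_g(a)` cancels the `θ_g⁻¹` in the multiplication of the
      -- crossed product.
      obtain ⟨a, rfl⟩ := (Θ.θ g).toLinearEquiv.surjective a
      rw [hθ]
      refine H.r_twist ((hD _ _).1 a.2) ((hD _ _).1 b.2) ?_
      have := hw g h (Θ.θRestrict g h (Θ.pairing g h a b))
      have e : ι (Θ.θRestrict g h (Θ.pairing g h a b)) = t g (ι a * ι b) := by
        rw [← map_mul]
        exact hθ g _
      rw [e] at this
      simp only [TwistedPartialAction.mulComponent, LinearMap.compr₂_apply, LinearMap.comp_apply,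
        LinearEquiv.coe_coe, LinearEquiv.symm_apply_apply]
      exact this
    exact fun x y => LinearMap.congr_fun₂ this x y
  refine ⟨Θ, ⟨ψ.symm, fun a b => ψ.injective ?_⟩, fun g => ?_⟩
  · change ψ (ψ.symm (a * b)) = ψ (ψ.symm a * ψ.symm b)
    rw [hmul]
    simp
  · ext x
    constructor
    · rintro ⟨c, hc, rfl⟩
      refine ⟨(ρ g).symm ⟨c, hc⟩, ψ.injective ?_⟩
      rw [hψ, ← hρ]
      simp
    · rintro ⟨a, rfl⟩
      refine ⟨ρ g a, (ρ g a).2, ψ.injective ?_⟩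
      rw [hψ, ← hρ]
      simp

end IsTrivialized

end Packaging

end

noncomputable section

/-! ### Matrices over `B_1` and conclusion -/

namespace FMat

variable {X k B : Type*} [CommRing k] [NonUnitalRing B] [Module k B]

/-- The inclusion of the matrices over a subalgebra, as a linear map. -/
def subalgebraInclusionLinear (X : Type*) (A : NonUnitalSubalgebra k B) :
    FMat X A →ₗ[k] FMat X B :=
  (Finsupp.mapRange.linearMap A.toSubmodule.subtype : (X × X →₀ A) →ₗ[k] (X × X →₀ B))

theorem subalgebraInclusionLinear_mul {A : NonUnitalSubalgebra k B} (a b : FMat X A) :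
    subalgebraInclusionLinear X A (a * b) =
      subalgebraInclusionLinear X A a * subalgebraInclusionLinear X A b := by
  classical
  ext x z
  change (((a * b).entry x z : A) : B) = _
  rw [entry_mul_of_subset _ _ _ _ (S := a.cols ∪ (subalgebraInclusionLinear X A a).cols)
    Finset.subset_union_left, AddSubmonoidClass.coe_finsetSum,
    entry_mul_of_subset _ _ _ _ (S := a.cols ∪ (subalgebraInclusionLinear X A a).cols)
    Finset.subset_union_right]
  rfl

/-- The inclusion of the matrices over a subalgebra. -/
def subalgebraInclusion (X : Type*) (A : NonUnitalSubalgebra k B) : FMat X A →ₙₐ[k] FMat X B where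
  toFun := subalgebraInclusionLinear X A
  map_smul' := map_smul _
  map_zero' := map_zero _
  map_add' := map_add _
  map_mul' := subalgebraInclusionLinear_mul

theorem entry_subalgebraInclusion {A : NonUnitalSubalgebra k B} (a : FMat X A) (x y : X) :
    (subalgebraInclusion X A a).entry x y = a.entry x y := rfl

theorem subalgebraInclusion_injective (A : NonUnitalSubalgebra k B) :
    Function.Injective (subalgebraInclusion X A) := fun a b h => by
  ext x y
  rw [← entry_subalgebraInclusion, h, entry_subalgebraInclusion]

theorem exists_subalgebraInclusion {A : NonUnitalSubalgebra k B} {c : FMat X B}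
    (hc : ∀ x y, c.entry x y ∈ A) : ∃ a, subalgebraInclusion X A a = c := by
  obtain ⟨f, hf⟩ := exists_ofRows (S := A.toSubmodule) hc
  exact ⟨f.uncurry, hf⟩

end FMat

theorem IsGrading.exists_isOrthogonalUnitSet {k G B : Type*} [CommRing k] [Group G]
    [DecidableEq G] [NonUnitalRing B] [Module k B] [IsScalarTower k B B] [SMulCommClass k B B]
    {𝓑 : G → Submodule k B} {h𝓑 : IsGrading 𝓑} (hE : h𝓑.HasEnoughLocalUnits) (g : G) :
    ∃ E, IsOrthogonalUnitSet (𝓑 g ⊙ 𝓑 g⁻¹) E :=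
  (hE g).exists_isOrthogonalUnitSet

theorem IsGrading.exists_isTrivialized {k G B : Type*} [CommRing k] [Group G]
    [DecidableEq G] [NonUnitalRing B] [Module k B] [IsScalarTower k B B] [SMulCommClass k B B]
    {𝓑 : G → Submodule k B} {h𝓑 : IsGrading 𝓑} (hB : ∀ g : G, 𝓑 g ⊙ 𝓑 g⁻¹ ⊙ 𝓑 g = 𝓑 g)
    (hE : h𝓑.HasEnoughLocalUnits) :
    ∃ r t, IsTrivialized (fun g => FMat.component (B × ℕ) (𝓑 g)) r t := by
  classical
  have one : 𝓑 1 ⊙ 𝓑 1 = 𝓑 1 := by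
    have le : 𝓑 1 ⊙ 𝓑 1 ≤ 𝓑 1 := spanMul_le.2 fun a ha b hb => by simpa using h𝓑.mul_mem ha hb
    refine le_antisymm le ?_
    have h1 := hB 1
    rw [inv_one] at h1
    calc 𝓑 1 = 𝓑 1 ⊙ 𝓑 1 ⊙ 𝓑 1 := h1.symm
      _ ≤ 𝓑 1 ⊙ 𝓑 1 := spanMul_mono le le_rfl
  have triv : ∀ g, ∃ r t, IsTrivialization (FMat.component (B × ℕ) (𝓑 g))
      (FMat.component (B × ℕ) (𝓑 g⁻¹)) r t ∧ (g = 1 → r = id) := by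
    intro g
    -- For `g = 1` the choice `u_1 = 1` is imposed, which the swindle would not provide: `θ_1 = id`
    -- and `w_{1,g} = w_{g,1} = 1` depend on it.
    by_cases hg : g = 1
    · subst hg
      refine ⟨id, id, ?_, fun _ => rfl⟩
      rw [inv_one]
      exact IsTrivialization.id (by rw [← FMat.component_spanMul, one])
    · obtain ⟨E, hE1⟩ := IsGrading.exists_isOrthogonalUnitSet hE g
      obtain ⟨E', hE2⟩ := IsGrading.exists_isOrthogonalUnitSet hE g⁻¹
      have h2 := hB g⁻¹
      rw [inv_inv] at hE2 h2
      obtain ⟨r, t, h⟩ := FMat.exists_isTrivialization_component hE1 hE2 (hB g) h2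
      exact ⟨r, t, h, fun h => absurd h hg⟩
  choose r t htriv hone using triv
  refine ⟨r, t, ?_, ?_, htriv, ?_, ?_⟩
  · intro g h a b ha hb x z
    rw [FMat.entry_mul]
    exact Submodule.sum_mem _ fun y _ => h𝓑.mul_mem (ha x y) (hb y z)
  · intro g
    obtain ⟨E, hE1⟩ := IsGrading.exists_isOrthogonalUnitSet hE g
    rw [gradedDom, ← FMat.component_spanMul]
    exact FMat.hasCommonUnits_component hE1.hasCommonUnits
  · intro x hx
    rwa [gradedDom, ← FMat.component_spanMul, inv_one, one]
  · intro x _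
    rw [hone 1 rfl, id]

end

theorem theorem7p2 {k : Type v} {G : Type w} {B : Type u} [CommRing k] [Group G] [DecidableEq G]
    [NonUnitalRing B] [Module k B] [IsScalarTower k B B] [SMulCommClass k B B]
    (𝓑 : G → Submodule k B) (h𝓑 : IsGrading 𝓑)
    (hB : ∀ g : G, 𝓑 g ⊙ 𝓑 g⁻¹ ⊙ 𝓑 g = 𝓑 g)
    (hE : h𝓑.HasEnoughLocalUnits) :
    ∃ (X : Type u) (_ : Infinite X)
      (Θ : TwistedPartialAction k G (FMat X h𝓑.unitComponent))
      (φ : NAlgIso k (FMat X B) Θ.CrossedProduct),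
      ∀ g : G, (FMat.component X (𝓑 g)).map (φ.toLinearEquiv : FMat X B →ₗ[k] Θ.CrossedProduct) =
        LinearMap.range (TwistedPartialAction.CrossedProduct.δ Θ g) := by
  obtain ⟨r, t, H⟩ := IsGrading.exists_isTrivialized hB hE
  exact ⟨B × ℕ, inferInstance, H.exists_crossedProduct_iso
    (FMat.subalgebraInclusion (B × ℕ) h𝓑.unitComponent) (fun a x y => (a.entry x y).2)
    (FMat.subalgebraInclusion_injective _) (fun c hc => FMat.exists_subalgebraInclusion hc)
    (FMat.isInternal_component h𝓑.internal)⟩
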